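/- Work over $\mathbb C$. Let $n\ge 2$, $d\ge 1$ and $k=d+1$. Let $|\mathcal O(d)|$ be the projective space of hypersurfaces of degree $d$ in $\mathbb P^n$, let $\pi\colon\mathfrak X\to|\mathcal O(d)|$ be the universal family of these hypersurfaces (so $\mathfrak X\subseteq |\mathcal O(d)|\times\mathbb P^n$), let $\mathcal L$ be the pullback of $\mathcal O(1)$ along the projection $\mathfrak X\to\mathbb P^n$, and let $V_k=\pi_*(\mathcal L^{\otimes k})$, a vector bundle of rank $r=\binom{k+n}{n}-\binom{k+n-d}{n}$. For a line $T\subseteq|\mathcal O(d)|$ the splitting type of $V_k|_T$ is the unique non-increasing tuple $(b_1,\dots,b_r)$ of integers such that $V_k|_T\cong\bigoplus_{j=1}^r\mathcal O_T(b_j)$. Let $f_1,f_2\in\mathbb C[x_0,\dots,x_n]$ be linearly independent homogeneous polynomials of degree $d$, and let $T\subseteq|\mathcal O(d)|$ be the line spanned by them. Then $V_k|_T$ has splitting type $(2,1,\dots,1,0,\dots,0)$, of length $r$ with exactly $n-1$ entries equal to $1$, if and only if $$\deg\gcd(f_1,f_2)\ge d-1.$$ -/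

import Mathlib

namespace Verlinde

open MvPolynomial

/-! ## The universal hypersurface

`ℙⁿ` has homogeneous coordinates `x₀, …, xₙ`, and the projective space `|𝒪(d)|` of hypersurfaces of
degree `d` has homogeneous coordinates `α_I`, one for every monomial `x^I` of degree `d`. -/

/-- The exponents `I` of the monomials `x^I` of degree `d` in `x₀, …, xₙ`. -/
abbrev Mon (n d : ℕ) : Type :=
  ↥((Finset.univ : Finset (Fin (n + 1))).finsuppAntidiag d)

/-- The homogeneous coordinate ring `S = ℂ[α_I]` of `|𝒪(d)|`. -/
abbrev BaseRing (n d : ℕ) : Type := MvPolynomial (Mon n d) ℂ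

/-- The bihomogeneous coordinate ring `S[x₀, …, xₙ]` of `|𝒪(d)| × ℙⁿ`. -/
abbrev BiRing (n d : ℕ) : Type := MvPolynomial (Fin (n + 1)) (BaseRing n d)

/-- The bihomogeneous equation `F = ∑_I α_I x^I` of the universal hypersurface `𝔛`. -/
noncomputable def universalForm (n d : ℕ) : BiRing n d :=
  ∑ I : Mon n d, monomial (I : Fin (n + 1) →₀ ℕ) (X I : BaseRing n d)

/-- The bihomogeneous coordinate ring `S[x₀, …, xₙ] / (F)` of the universal hypersurface
`𝔛 ⊆ |𝒪(d)| × ℙⁿ`. -/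
def UniversalRing (n d : ℕ) : Type := BiRing n d ⧸ Ideal.span {universalForm n d}

noncomputable instance (n d : ℕ) : CommRing (UniversalRing n d) :=
  Ideal.Quotient.commRing (Ideal.span {universalForm n d})

/-- The quotient map `S[x₀, …, xₙ] → S[x₀, …, xₙ] / (F)`. -/
noncomputable def toUniversal (n d : ℕ) : BiRing n d →+* UniversalRing n d :=
  Ideal.Quotient.mk (Ideal.span {universalForm n d})

noncomputable instance (n d : ℕ) : Algebra (BaseRing n d) (UniversalRing n d) :=
  ((toUniversal n d).comp C).toAlgebra

/-- The class of `x_i` in the coordinate ring of `𝔛`. -/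
noncomputable def coord (n d : ℕ) (i : Fin (n + 1)) : UniversalRing n d :=
  toUniversal n d (X i)

/-- The functions on the chart `x_i ≠ 0` (over the affine cone `Spec S` of `|𝒪(d)|`). -/
abbrev ChartRing (n d : ℕ) (i : Fin (n + 1)) : Type := Localization.Away (coord n d i)

/-- The functions on the overlap `x_i x_j ≠ 0`. -/
abbrev OverlapRing (n d : ℕ) (i j : Fin (n + 1)) : Type :=
  Localization.Away (coord n d i * coord n d j)

/-- Restriction of functions from the chart `x_i ≠ 0` to the overlap `x_i x_j ≠ 0`. -/
noncomputable def resLeft (n d : ℕ) (i j : Fin (n + 1)) :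
    ChartRing n d i →+* OverlapRing n d i j :=
  IsLocalization.Away.awayToAwayRight (coord n d i) (coord n d j)

/-- Restriction of functions from the chart `x_j ≠ 0` to the overlap `x_i x_j ≠ 0`. -/
noncomputable def resRight (n d : ℕ) (i j : Fin (n + 1)) :
    ChartRing n d j →+* OverlapRing n d i j :=
  IsLocalization.Away.awayToAwayLeft (coord n d j) (coord n d i)

/-- The canonical map from the coordinate ring of `𝔛` to the functions on the chart `x_i ≠ 0`. -/
noncomputable abbrev toChart (n d : ℕ) (i : Fin (n + 1)) : UniversalRing n d →+* ChartRing n d i :=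
  algebraMap (UniversalRing n d) (ChartRing n d i)

/-- `IsFrac i k P s`: the element `s` is a fraction `g / x_i ^ a` where `g` is homogeneous of
degree `k + a` in the variables `x`, with coefficients in `S` satisfying `P`. For `P` trivial these
are the sections of `𝒪(k)` over the chart `x_i ≠ 0`. -/
def IsFrac {n d : ℕ} (i : Fin (n + 1)) (k : ℕ) (P : BaseRing n d → Prop)
    (s : ChartRing n d i) : Prop :=
  ∃ (a : ℕ) (g : BiRing n d), g.IsHomogeneous (k + a) ∧ (∀ v, P (g.coeff v)) ∧
    s * toChart n d i (coord n d i) ^ a = toChart n d i (toUniversal n d g)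

lemma IsFrac.zero {n d : ℕ} {i : Fin (n + 1)} {k : ℕ} {P : BaseRing n d → Prop} (h0 : P 0) :
    IsFrac i k P 0 :=
  ⟨0, 0, isHomogeneous_zero _ _ _, fun v => by simpa using h0, by simp⟩

lemma IsFrac.add {n d : ℕ} {i : Fin (n + 1)} {k : ℕ} {P : BaseRing n d → Prop}
    (h0 : P 0) (hadd : ∀ u v, P u → P v → P (u + v)) {s t : ChartRing n d i}
    (hs : IsFrac i k P s) (ht : IsFrac i k P t) : IsFrac i k P (s + t) := by
  obtain ⟨a, g, hg, hgP, hs⟩ := hs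
  obtain ⟨b, h, hh, hhP, ht⟩ := ht
  have key : ∀ (q : BiRing n d) (c : ℕ), (∀ v, P (q.coeff v)) →
      ∀ v, P ((q * X i ^ c).coeff v) := by
    intro q c hq v
    rw [X_pow_eq_monomial, coeff_mul_monomial']
    split_ifs
    · simpa using hq _
    · exact h0
  refine ⟨a + b, g * X i ^ b + h * X i ^ a, ?_, ?_, ?_⟩
  · refine IsHomogeneous.add ?_ ?_
    · have := hg.mul (isHomogeneous_X_pow (R := BaseRing n d) i b)
      rwa [add_assoc] at this
    · have := hh.mul (isHomogeneous_X_pow (R := BaseRing n d) i a)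
      rwa [add_assoc, add_comm b a] at this
  · intro v
    rw [coeff_add]
    exact hadd _ _ (key g b hgP v) (key h a hhP v)
  · have hx : toUniversal n d (X i) = coord n d i := rfl
    simp only [map_add, map_mul, map_pow, hx, ← hs, ← ht]
    ring

lemma IsFrac.smul {n d : ℕ} {i : Fin (n + 1)} {k : ℕ} {P Q : BaseRing n d → Prop}
    (c : BaseRing n d) (hc : ∀ u, P u → Q (c * u)) {s : ChartRing n d i}
    (hs : IsFrac i k P s) : IsFrac i k Q (c • s) := by
  obtain ⟨a, g, hg, hgP, hs⟩ := hs
  refine ⟨a, c • g, ?_, ?_, ?_⟩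
  · rw [smul_eq_C_mul]
    simpa using (isHomogeneous_C (Fin (n + 1)) c).mul hg
  · intro v
    rw [coeff_smul, smul_eq_mul]
    exact hc _ (hgP v)
  · rw [smul_mul_assoc, hs, Algebra.smul_def, smul_eq_C_mul, map_mul, map_mul,
      IsScalarTower.algebraMap_apply (BaseRing n d) (UniversalRing n d)]
    rfl

lemma resLeft_smul {n d : ℕ} (i j : Fin (n + 1)) (c : BaseRing n d) (s : ChartRing n d i) :
    resLeft n d i j (c • s) = c • resLeft n d i j s := by
  rw [Algebra.smul_def, Algebra.smul_def, map_mul,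
    IsScalarTower.algebraMap_apply (BaseRing n d) (UniversalRing n d) (ChartRing n d i),
    IsScalarTower.algebraMap_apply (BaseRing n d) (UniversalRing n d) (OverlapRing n d i j),
    resLeft, IsLocalization.Away.awayToAwayRight_eq]

lemma resRight_smul {n d : ℕ} (i j : Fin (n + 1)) (c : BaseRing n d) (s : ChartRing n d j) :
    resRight n d i j (c • s) = c • resRight n d i j s := by
  rw [Algebra.smul_def, Algebra.smul_def, map_mul,
    IsScalarTower.algebraMap_apply (BaseRing n d) (UniversalRing n d) (ChartRing n d j),
    IsScalarTower.algebraMap_apply (BaseRing n d) (UniversalRing n d) (OverlapRing n d i j),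
    resRight, IsLocalization.Away.awayToAwayLeft_eq]

/-! ## The Verlinde bundle -/

/-- The graded `S`-module whose associated sheaf on `|𝒪(d)| = Proj S` is the `k`-th Verlinde bundle
`V_k = π_* (ℒ ^ k)`, where `π : 𝔛 → |𝒪(d)|` is the projection and `ℒ` is the pullback of `𝒪(1)` from
`ℙⁿ`. It consists of the sections of `𝒪(k)` on `{(c, x) ∈ Spec S × ℙⁿ | F(c, x) = 0}`, the pullback
of `𝔛` to the affine cone over `|𝒪(d)|`, i.e. of the families of sections over the charts `x_i ≠ 0`
that agree on the overlaps. As localization commutes with this finite gluing condition, the degree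
`0` part of its localization at a homogeneous `h ∈ S` of positive degree is the module
`Γ(π⁻¹(D₊(h)), ℒ ^ k) = Γ(D₊(h), V_k)`. -/
noncomputable def VerlindeModule (n d k : ℕ) :
    Submodule (BaseRing n d) (∀ i : Fin (n + 1), ChartRing n d i) where
  carrier := {s | (∀ i, IsFrac i k (fun _ => True) (s i)) ∧
    ∀ i j, resLeft n d i j (s i) = resRight n d i j (s j)}
  zero_mem' := ⟨fun _ => IsFrac.zero trivial, fun i j => by simp⟩
  add_mem' := fun {s t} hs ht =>
    ⟨fun i => (hs.1 i).add trivial (fun _ _ _ _ => trivial) (ht.1 i), fun i j => by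
      simp only [Pi.add_apply, map_add, hs.2 i j, ht.2 i j]⟩
  smul_mem' := fun c s hs =>
    ⟨fun i => (hs.1 i).smul c (fun _ _ => trivial), fun i j => by
      simp only [Pi.smul_apply, resLeft_smul, resRight_smul, hs.2 i j]⟩

/-- The degree `m` part of the Verlinde module: the sections that are homogeneous of degree `m` in
the variables `α_I`. -/
noncomputable def verlindeDegree (n d k m : ℕ) : AddSubgroup (VerlindeModule n d k) where
  carrier := {s | ∀ i, IsFrac i k (fun c => c.IsHomogeneous m) (s.1 i)}
  zero_mem' := fun _ => IsFrac.zero (isHomogeneous_zero _ _ _)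
  add_mem' := fun {s t} hs ht i =>
    (hs i).add (isHomogeneous_zero _ _ _) (fun _ _ hu hv => hu.add hv) (ht i)
  neg_mem' := fun {s} hs i => by
    have h := (hs i).smul (Q := fun c => c.IsHomogeneous m) (-1 : BaseRing n d)
      (fun u hu => by simpa using hu.neg)
    simpa using h

/-! ## Restriction to a line

The line `T ⊆ |𝒪(d)|` spanned by `f₁` and `f₂` is the image of the closed immersion
`ℙ¹ → |𝒪(d)|, (s : t) ↦ s f₁ + t f₂`. -/

/-- The homogeneous coordinate ring `ℂ[s, t]` of `ℙ¹`. -/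
abbrev LineRing : Type := MvPolynomial (Fin 2) ℂ

/-- The homomorphism `S → ℂ[s, t]` given by restriction to the line: `α_I` is sent to the
coefficient of `x^I` in `s f₁ + t f₂`. -/
noncomputable def restrictToLine {n : ℕ} (d : ℕ) (f₁ f₂ : MvPolynomial (Fin (n + 1)) ℂ) :
    BaseRing n d →+* LineRing :=
  (aeval fun I : Mon n d =>
    (C (f₁.coeff I) * X 0 + C (f₂.coeff I) * X 1 : LineRing)).toRingHom

/-- The graded `ℂ[s, t]`-module `ℂ[s, t] ⊗_S VerlindeModule`, whose associated sheaf on `ℙ¹` is the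
restriction `V_{k,T}` of the Verlinde bundle to the line `T` spanned by `f₁` and `f₂`. -/
def LineModule {n : ℕ} (d k : ℕ) (f₁ f₂ : MvPolynomial (Fin (n + 1)) ℂ) : Type :=
  letI := (restrictToLine d f₁ f₂).toAlgebra
  TensorProduct (BaseRing n d) LineRing (VerlindeModule n d k)

noncomputable instance {n : ℕ} (d k : ℕ) (f₁ f₂ : MvPolynomial (Fin (n + 1)) ℂ) :
    AddCommGroup (LineModule d k f₁ f₂) :=
  letI := (restrictToLine d f₁ f₂).toAlgebra
  (inferInstance : AddCommGroup (TensorProduct (BaseRing n d) LineRing (VerlindeModule n d k)))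

noncomputable instance {n : ℕ} (d k : ℕ) (f₁ f₂ : MvPolynomial (Fin (n + 1)) ℂ) :
    Module LineRing (LineModule d k f₁ f₂) :=
  letI := (restrictToLine d f₁ f₂).toAlgebra
  (inferInstance : Module LineRing (TensorProduct (BaseRing n d) LineRing (VerlindeModule n d k)))

/-- The pure tensor `p ⊗ s`. -/
noncomputable def LineModule.tmul {n : ℕ} (d k : ℕ) (f₁ f₂ : MvPolynomial (Fin (n + 1)) ℂ)
    (p : LineRing) (s : VerlindeModule n d k) : LineModule d k f₁ f₂ :=
  letI := (restrictToLine d f₁ f₂).toAlgebra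
  TensorProduct.tmul (BaseRing n d) p s

/-- The degree `m` part of `LineModule`, generated by the tensors `p ⊗ s` of homogeneous elements
whose degrees add up to `m`. -/
noncomputable def lineDegree {n : ℕ} (d k : ℕ) (f₁ f₂ : MvPolynomial (Fin (n + 1)) ℂ) (m : ℕ) :
    AddSubgroup (LineModule d k f₁ f₂) :=
  AddSubgroup.closure {y | ∃ (a b : ℕ) (p : LineRing) (s : VerlindeModule n d k), a + b = m ∧
    p.IsHomogeneous a ∧ s ∈ verlindeDegree n d k b ∧ y = LineModule.tmul d k f₁ f₂ p s}

/-! ## Sheaves on `ℙ¹` and splitting types -/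

/-- The sections over the chart `D₊(z)`, where `z` is the `i`-th homogeneous coordinate of `ℙ¹`, of
the sheaf on `ℙ¹` associated with a graded module `M`: the fractions of degree `0` in `M[1/z]`. -/
def chartSections {M : Type*} [AddCommGroup M] [Module LineRing M] (deg : ℕ → AddSubgroup M)
    (i : Fin 2) : Set (LocalizedModule (Submonoid.powers (X i : LineRing)) M) :=
  {y | ∃ (a : ℕ) (p : M), p ∈ deg a ∧
    y = LocalizedModule.mk p (Submonoid.pow (X i : LineRing) a)}

/-- The sheaves on `ℙ¹ = Proj ℂ[s, t]` associated with two graded modules `M` and `N` are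
isomorphic: over each of the two standard charts `D₊(z)` there is an isomorphism, given as a linear
isomorphism `M[1/z] ≃ N[1/z]` that matches the fractions of degree `0` (as `z` is a unit of degree
`1` in `ℂ[s, t][1/z]`, such a map is the same as an isomorphism, linear over the degree `0` part of
`ℂ[s, t][1/z]`, between the degree `0` parts), and the two isomorphisms agree over the overlap of
the charts. -/
def SheafIso {M N : Type*} [AddCommGroup M] [Module LineRing M] [AddCommGroup N] [Module LineRing N]
    (degM : ℕ → AddSubgroup M) (degN : ℕ → AddSubgroup N) : Prop :=
  ∃ Φ : ∀ i : Fin 2, LocalizedModule (Submonoid.powers (X i : LineRing)) M ≃ₗ[LineRing]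
      LocalizedModule (Submonoid.powers (X i : LineRing)) N,
    (∀ i y, Φ i y ∈ chartSections degN i ↔ y ∈ chartSections degM i) ∧
    ∀ x : M,
      LocalizedModule.liftOfLE (Submonoid.powers (X 0 : LineRing))
          (Submonoid.powers (X 0 : LineRing) ⊔ Submonoid.powers (X 1 : LineRing)) le_sup_left
          (Φ 0 (LocalizedModule.mk x 1)) =
        LocalizedModule.liftOfLE (Submonoid.powers (X 1 : LineRing))
          (Submonoid.powers (X 0 : LineRing) ⊔ Submonoid.powers (X 1 : LineRing)) le_sup_right
          (Φ 1 (LocalizedModule.mk x 1))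

/-- The degree `m` part of the graded `ℂ[s, t]`-module `⨁_j ℂ[s, t](b_j)`, whose associated sheaf
is `⨁_j 𝒪(b_j)`: its `j`-th component is homogeneous of degree `m + b_j`. -/
noncomputable def twistDegree {r : ℕ} (b : Fin r → ℤ) (m : ℕ) : AddSubgroup (Fin r → LineRing) where
  carrier := {q | ∀ j, ∀ v ∈ (q j).support, (v.degree : ℤ) = m + b j}
  zero_mem' := fun j v hv => by simp at hv
  add_mem' := fun {p q} hp hq j v hv => by
    rcases Finset.mem_union.1 (support_add hv) with h | h
    · exact hp j v h
    · exact hq j v h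
  neg_mem' := fun {q} hq j v hv => hq j v (by simpa using hv)

/-- `V_{k,T}`, for the line `T ⊆ |𝒪(d)|` spanned by `f₁` and `f₂`, has splitting type
`b = (b₁, …, b_r)`: the tuple is non-increasing and `V_{k,T} ≅ ⨁_j 𝒪(b_j)`. -/
def HasSplittingType {n : ℕ} (d k : ℕ) (f₁ f₂ : MvPolynomial (Fin (n + 1)) ℂ) {r : ℕ}
    (b : Fin r → ℤ) : Prop :=
  Antitone b ∧ SheafIso (lineDegree d k f₁ f₂) (twistDegree b)

/-- The rank of the `k`-th Verlinde bundle of hypersurfaces of degree `d` in `ℙⁿ`, for `d ≤ k`. -/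
def verlindeRank (n d k : ℕ) : ℕ := (k + n).choose n - (k + n - d).choose n

/-- The tuple `(2, 1, …, 1, 0, …, 0)` of length `r` with `n - 1` entries `1`, so that for
`r ≥ n ≥ 1` its entries add up to `n + 1`. -/
def jumpingType (n r : ℕ) (j : Fin r) : ℤ :=
  if (j : ℕ) = 0 then 2 else if (j : ℕ) < n then 1 else 0

/-- A greatest common divisor of two polynomials (unique up to a nonzero constant). -/
noncomputable def polyGcd {n : ℕ} (f₁ f₂ : MvPolynomial (Fin (n + 1)) ℂ) :
    MvPolynomial (Fin (n + 1)) ℂ :=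
  (UniqueFactorizationMonoid.toGCDMonoid (MvPolynomial (Fin (n + 1)) ℂ)).gcd f₁ f₂

end Verlinde

/-! Since `n ≥ 2`, two distinct coordinates `x_i`, `x_j` form a regular sequence modulo the
universal form `F`, so sections of `𝒪(k)` on `𝔛` are exactly forms of degree `k` modulo `F`
(`globalSection_surjective`, `globalSection_eq_zero_iff`). With `k = d + 1`, restriction to `T`
presents `V_k|_T` as the cokernel of multiplication by `s f₁ + t f₂`, a map from `H⁰(𝒪(1)) ⊗ 𝒪(-1)`
to `H⁰(𝒪(d+1)) ⊗ 𝒪` (`lineClass_eq_zero_iff`, `exists_injective_of_ker_eq`). Everything then depends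
on the linear relations among the products of `f₁` and `f₂` with linear forms.

If the gcd has degree below `d - 1`, there are no relations (`linearIndependent_generic`). Each
linear form contributes a cokernel of `(s, t) : 𝒪(-1) → 𝒪²`, which is `𝒪(1)`. So the bundle embeds
in a sum of copies of `𝒪(1)` and `𝒪`, and such a sum receives no nonzero map from `𝒪(2)`
(`not_sheafIso_twistDegree`).

Otherwise `f₁ = g a` and `f₂ = g b` with `a`, `b` independent linear forms, and the only relation is
`f₁ b = f₂ a` (`exists_linear_factors`, `linearIndependent_special`). The forms `a` and `b` together
contribute a cokernel of `𝒪(-1)² → 𝒪³`, which is `𝒪(2)` (`exists_of_quadratic_relation`). The other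
`n - 1` linear forms contribute one `𝒪(1)` each, and the remaining forms of degree `d + 1` give
trivial summands. The explicit map `specialMap` becomes an isomorphism on both charts of `ℙ¹` by
`sheafIso_of_injective`. -/

namespace Verlinde

open MvPolynomial

/-! ### Regular sequences of coordinates modulo the universal form -/

section UniversalRing

variable {n d : ℕ}

/-- Evaluation at the hypersurface `x_j ^ d = 0` and the `j`-th coordinate point. -/
noncomputable def coordEval (n d : ℕ) (j : Fin (n + 1)) : BiRing n d →+* ℂ :=
  eval₂Hom (eval fun I : Mon n d => if (I : Fin (n + 1) →₀ ℕ) = Finsupp.single j d then 1 else 0)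
    (Pi.single j 1)

lemma coordEval_X_of_ne {i j : Fin (n + 1)} (h : i ≠ j) : coordEval n d j (X i) = 0 := by
  simp [coordEval, h]

lemma coordEval_universalForm (j : Fin (n + 1)) : coordEval n d j (universalForm n d) = 1 := by
  have hmem : Finsupp.single j d ∈ (Finset.univ : Finset (Fin (n + 1))).finsuppAntidiag d := by
    simp [Finset.mem_finsuppAntidiag, Finsupp.single_apply]
  rw [universalForm, map_sum, Finset.sum_eq_single ⟨_, hmem⟩]
  · simp [coordEval]
  · intro I _ hI
    have : (I : Fin (n + 1) →₀ ℕ) ≠ Finsupp.single j d := fun h => hI (Subtype.ext h)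
    simp [coordEval, this]
  · simp

/-- At another coordinate point `j ≠ i`, on the hypersurface `x_j ^ d = 0`, the variable `x_i`
vanishes but `F` takes the value `1`. -/
lemma not_X_dvd_universalForm (hn : 1 ≤ n) (i : Fin (n + 1)) : ¬ X i ∣ universalForm n d := by
  have : Nontrivial (Fin (n + 1)) := Fin.nontrivial_iff_two_le.2 (by omega)
  rintro ⟨g, hg⟩
  obtain ⟨j, hj⟩ := exists_ne i
  have := congrArg (coordEval n d j) hg
  rw [coordEval_universalForm, map_mul, coordEval_X_of_ne hj.symm, zero_mul] at this
  exact one_ne_zero this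

lemma universalForm_dvd_of_dvd_X_mul (hn : 1 ≤ n) (i : Fin (n + 1)) {g : BiRing n d}
    (h : universalForm n d ∣ X i * g) : universalForm n d ∣ g := by
  obtain ⟨u, hu⟩ := h
  rcases (X_prime (R := BaseRing n d) (i := i)).dvd_or_dvd (Dvd.intro g hu) with h | ⟨v, rfl⟩
  · exact absurd h (not_X_dvd_universalForm hn i)
  · refine ⟨v, mul_left_cancel₀ (X_ne_zero (R := BaseRing n d) i) ?_⟩
    rw [hu]; ring

lemma universalForm_dvd_of_dvd_X_pow_mul (hn : 1 ≤ n) (i : Fin (n + 1)) {g : BiRing n d} (a : ℕ)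
    (h : universalForm n d ∣ X i ^ a * g) : universalForm n d ∣ g := by
  induction a with
  | zero => simpa using h
  | succ a ih =>
    rw [pow_succ', mul_assoc] at h
    exact ih (universalForm_dvd_of_dvd_X_mul hn i h)

/-- `F` is not in the prime ideal generated by two of the variables. -/
lemma exists_of_X_mul_add_eq_universalForm_mul (hn : 2 ≤ n) {i j : Fin (n + 1)}
    {u v h : BiRing n d} (e : X i * u + X j * v = universalForm n d * h) :
    ∃ p q, h = X i * p + X j * q := by
  classical
  -- This is where `n ≥ 2` enters: a third coordinate point exists, and `F` can be made nonzero
  -- there.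
  obtain ⟨l, hl⟩ : ∃ l : Fin (n + 1), l ∉ ({i, j} : Finset _) := by
    by_contra! hc
    have := Finset.card_le_card (fun l _ => hc l : (Finset.univ : Finset (Fin (n + 1))) ⊆ {i, j})
    have h2 := Finset.card_le_two (a := i) (b := j)
    simp at this
    omega
  simp only [Finset.mem_insert, Finset.mem_singleton, not_or] at hl
  -- Setting `x_i = x_j = 0` is the identity modulo `(x_i, x_j)`. It therefore suffices that `h` is
  -- killed, which follows since the image of `F` is nonzero in a domain.
  let ev : BiRing n d →ₐ[BaseRing n d] BiRing n d :=
    aeval fun m => if m = i ∨ m = j then 0 else X m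
  have hev : (coordEval n d l).comp ev.toRingHom = coordEval n d l := by
    refine MvPolynomial.ringHom_ext (fun r => ?_) fun m => ?_
    · simp [ev]
    · by_cases hm : m = i ∨ m = j
      · have : m ≠ l := by rintro rfl; tauto
        simp [ev, hm, coordEval_X_of_ne this]
      · simp [ev, hm]
  have hF : ev (universalForm n d) ≠ 0 := fun h0 => by
    have := congrArg (fun f => f (universalForm n d)) hev
    simp [h0, coordEval_universalForm] at this
  have hh : ev h = 0 := by
    have := congrArg ev e
    simp only [map_add, map_mul] at this
    rw [show ev (X i) = 0 by simp [ev], show ev (X j) = 0 by simp [ev]] at this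
    simpa [hF] using this
  have hmk : ((Ideal.Quotient.mk (Ideal.span {(X i : BiRing n d), X j})).comp ev.toRingHom) =
      Ideal.Quotient.mk _ := by
    refine MvPolynomial.ringHom_ext (fun r => ?_) fun m => ?_
    · simp [ev]
    · by_cases hm : m = i ∨ m = j
      · have : (X m : BiRing n d) ∈ Ideal.span {(X i : BiRing n d), X j} := by
          rcases hm with rfl | rfl <;> exact Ideal.subset_span (by simp)
        simp [ev, hm, Ideal.Quotient.eq_zero_iff_mem.2 this]
      · simp [ev, hm]
  have := congrArg (fun f => f h) hmk
  simp only [RingHom.comp_apply, AlgHom.toRingHom_eq_coe, RingHom.coe_coe, hh, map_zero] at this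
  obtain ⟨p, q, hpq⟩ := Ideal.mem_span_pair.1 (Ideal.Quotient.eq_zero_iff_mem.1 this.symm)
  exact ⟨p, q, by rw [← hpq]; ring⟩

/-- This says that `x_j` is regular modulo `(x_i ^ a, F)`. In the induction step `F h` lies in
`(x_i, x_j)`, hence so does `h = x_i p + x_j q`. Then `x_i` divides `g - F q`, and cancelling it
lowers `a` by one. -/
lemma exists_of_X_mul_eq (hn : 2 ≤ n) {i j : Fin (n + 1)} (hij : i ≠ j) (a : ℕ)
    {g u h : BiRing n d} (e : X j * g = X i ^ a * u + universalForm n d * h) :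
    ∃ p q, g = X i ^ a * p + universalForm n d * q := by
  induction a generalizing g h with
  | zero => exact ⟨g, 0, by simp⟩
  | succ a ih =>
    obtain ⟨p, q, rfl⟩ := exists_of_X_mul_add_eq_universalForm_mul hn (i := i) (j := j)
      (u := - X i ^ a * u) (v := g) (h := h) (by rw [e]; ring)
    obtain ⟨g', hg'⟩ : X i ∣ g - universalForm n d * q := by
      have : X i ∣ X j * (g - universalForm n d * q) :=
        ⟨X i ^ a * u + universalForm n d * p, by rw [mul_sub, e]; ring⟩
      refine ((X_prime (R := BaseRing n d) (i := i)).dvd_or_dvd this).resolve_left fun h => ?_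
      exact hij (X_dvd_X.1 h)
    obtain ⟨p', q', hpq⟩ := ih (g := g') (h := p) (by
      refine mul_left_cancel₀ (X_ne_zero (R := BaseRing n d) i) ?_
      rw [← mul_assoc, mul_comm (X i) (X j), mul_assoc, ← hg', mul_sub, e]; ring)
    exact ⟨p', q + X i * q', by rw [← sub_add_cancel g (universalForm n d * q), hg', hpq]; ring⟩

lemma exists_of_X_pow_mul_eq (hn : 2 ≤ n) {i j : Fin (n + 1)} (hij : i ≠ j) (a b : ℕ)
    {g u h : BiRing n d} (e : X j ^ b * g = X i ^ a * u + universalForm n d * h) :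
    ∃ p q, g = X i ^ a * p + universalForm n d * q := by
  induction b generalizing u h with
  | zero => exact ⟨u, h, by simpa using e⟩
  | succ b ih =>
    rw [pow_succ', mul_assoc] at e
    obtain ⟨p, q, hpq⟩ := exists_of_X_mul_eq hn hij a e
    exact ih hpq

lemma toUniversal_eq_zero {g : BiRing n d} :
    toUniversal n d g = 0 ↔ universalForm n d ∣ g := by
  rw [toUniversal]
  exact Ideal.Quotient.eq_zero_iff_mem.trans Ideal.mem_span_singleton

lemma toUniversal_eq_iff {g h : BiRing n d} :
    toUniversal n d g = toUniversal n d h ↔ universalForm n d ∣ g - h := by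
  rw [← sub_eq_zero, ← map_sub, toUniversal_eq_zero]

lemma toUniversal_surjective : Function.Surjective (toUniversal n d) :=
  Ideal.Quotient.mk_surjective

lemma coord_mem_nonZeroDivisors (hn : 1 ≤ n) (i : Fin (n + 1)) :
    coord n d i ∈ nonZeroDivisors (UniversalRing n d) := by
  rw [mem_nonZeroDivisors_iff_right]
  intro y hy
  obtain ⟨g, rfl⟩ := toUniversal_surjective y
  rw [coord, ← map_mul, toUniversal_eq_zero, mul_comm] at hy
  exact toUniversal_eq_zero.2 (universalForm_dvd_of_dvd_X_mul hn i hy)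

lemma toChart_injective (hn : 1 ≤ n) (i : Fin (n + 1)) : Function.Injective (toChart n d i) :=
  IsLocalization.injective (ChartRing n d i)
    (Submonoid.powers_le.2 (coord_mem_nonZeroDivisors hn i))

lemma toOverlap_injective (hn : 1 ≤ n) (i j : Fin (n + 1)) :
    Function.Injective (algebraMap (UniversalRing n d) (OverlapRing n d i j)) :=
  IsLocalization.injective (OverlapRing n d i j) (Submonoid.powers_le.2
    (mul_mem (coord_mem_nonZeroDivisors hn i) (coord_mem_nonZeroDivisors hn j)))

lemma isUnit_toChart_coord (i : Fin (n + 1)) : IsUnit (toChart n d i (coord n d i)) :=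
  IsLocalization.Away.algebraMap_isUnit (coord n d i)

lemma resLeft_toChart (i j : Fin (n + 1)) (y : UniversalRing n d) :
    resLeft n d i j (toChart n d i y) = algebraMap _ _ y :=
  IsLocalization.Away.awayToAwayRight_eq _ _ _

lemma resRight_toChart (i j : Fin (n + 1)) (y : UniversalRing n d) :
    resRight n d i j (toChart n d j y) = algebraMap _ _ y :=
  IsLocalization.Away.awayToAwayLeft_eq _ _ _

lemma universalForm_isHomogeneous : (universalForm n d).IsHomogeneous d := by
  refine IsHomogeneous.sum _ _ _ fun I _ => isHomogeneous_monomial _ ?_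
  have := (Finset.mem_finsuppAntidiag.1 I.2).1
  rw [Finsupp.degree_eq_sum]
  exact this

end UniversalRing

/-! ### Homogeneous components, in the `x` and in the coefficients -/

section

attribute [local instance] MvPolynomial.gradedAlgebra

lemma homogeneousComponent_mul_of_isHomogeneous {σ R : Type*} [CommRing R] {a : ℕ}
    {f : MvPolynomial σ R} (hf : f.IsHomogeneous a) (b : ℕ) (g : MvPolynomial σ R) :
    homogeneousComponent (a + b) (f * g) = f * homogeneousComponent b g := by
  have := DirectSum.coe_decompose_mul_add_of_left_mem (homogeneousSubmodule σ R)
    (i := a) (j := b) (a := f) (b := g) hf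
  rw [← decomposition.decompose'_apply, ← decomposition.decompose'_apply]
  exact this

lemma dvd_homogeneousComponent {σ R : Type*} [CommRing R] {a : ℕ}
    {f g : MvPolynomial σ R} (hf : f.IsHomogeneous a) (h : f ∣ g) (b : ℕ) :
    f ∣ homogeneousComponent b g := by
  rw [← Ideal.mem_span_singleton] at h ⊢
  refine homogeneousComponent_mem_of_mem (Ideal.homogeneous_span _ _ ?_) h b
  rintro x rfl
  exact ⟨a, hf⟩

end

lemma exists_isHomogeneous_of_dvd {σ R : Type*} [CommRing R] {a b : ℕ}
    {f g : MvPolynomial σ R} (hf : f.IsHomogeneous a) (hg : g.IsHomogeneous (a + b)) (h : f ∣ g) :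
    ∃ p, p.IsHomogeneous b ∧ g = f * p := by
  obtain ⟨p, rfl⟩ := h
  exact ⟨homogeneousComponent b p, homogeneousComponent_isHomogeneous _ _, by
    rw [← homogeneousComponent_mul_of_isHomogeneous hf, homogeneousComponent_eq_self hg]⟩

/-- The part of a bigraded polynomial whose coefficients are homogeneous of degree
`m` in the variables `α_I`. -/
noncomputable def coeffComponent {σ τ R : Type*} [CommRing R] (m : ℕ)
    (g : MvPolynomial σ (MvPolynomial τ R)) : MvPolynomial σ (MvPolynomial τ R) :=
  ∑ v ∈ g.support, monomial v (homogeneousComponent m (g.coeff v))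

section coeffComponent

variable {σ τ R : Type*} [CommRing R]

@[simp]
lemma coeff_coeffComponent (m : ℕ) (g : MvPolynomial σ (MvPolynomial τ R)) (v : σ →₀ ℕ) :
    (coeffComponent m g).coeff v = homogeneousComponent m (g.coeff v) := by
  classical
  simp only [coeffComponent, coeff_sum, coeff_monomial]
  rw [Finset.sum_ite_eq']
  split_ifs with h
  · rfl
  · rw [notMem_support_iff.1 h, map_zero]

lemma coeffComponent_sum {ι : Type*} (m : ℕ) (s : Finset ι)
    (g : ι → MvPolynomial σ (MvPolynomial τ R)) :
    coeffComponent m (∑ i ∈ s, g i) = ∑ i ∈ s, coeffComponent m (g i) := by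
  ext1 v
  simp [coeff_sum]

lemma coeffComponent_sub (m : ℕ) (g h : MvPolynomial σ (MvPolynomial τ R)) :
    coeffComponent m (g - h) = coeffComponent m g - coeffComponent m h := by
  ext1 v
  simp

lemma coeffComponent_monomial_mul (m e : ℕ) (v : σ →₀ ℕ) {c : MvPolynomial τ R}
    (hc : c.IsHomogeneous e) (g : MvPolynomial σ (MvPolynomial τ R)) :
    coeffComponent (e + m) (monomial v c * g) = monomial v c * coeffComponent m g := by
  classical
  ext1 w
  rw [coeff_coeffComponent, coeff_monomial_mul', coeff_monomial_mul']
  split_ifs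
  · rw [homogeneousComponent_mul_of_isHomogeneous hc, coeff_coeffComponent]
  · simp

lemma coeffComponent_zero_monomial_mul (v : σ →₀ ℕ) {c : MvPolynomial τ R}
    (hc : c.IsHomogeneous 1) (g : MvPolynomial σ (MvPolynomial τ R)) :
    coeffComponent 0 (monomial v c * g) = 0 := by
  classical
  ext1 w
  have h0 : constantCoeff c = 0 := hc.coeff_eq_zero (d := 0) (by simp)
  rw [coeff_coeffComponent, coeff_monomial_mul']
  split_ifs
  · rw [homogeneousComponent_zero, ← constantCoeff_eq, map_mul, h0]; simp
  · simp

lemma coeffComponent_isHomogeneous (m : ℕ) {k : ℕ} {g : MvPolynomial σ (MvPolynomial τ R)}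
    (hg : g.IsHomogeneous k) : (coeffComponent m g).IsHomogeneous k := by
  refine IsHomogeneous.sum _ _ _ fun v hv => isHomogeneous_monomial _ ?_
  rw [hg.degree_eq_sum_deg_support hv]
  rw [Finsupp.degree_apply]

end coeffComponent

/-! ### Sections over the universal hypersurface are forms modulo `F` -/

section GlobalSections

variable {n d k : ℕ}

/-- `F` is linear in the `α_I`: the part of `F h` of positive degree `m + 1` in `α` is `F` times the
degree `m` part of `h`, and the part of degree `0` vanishes. -/
lemma exists_coeffComponent_universalForm_mul (m : ℕ) (h : BiRing n d) :
    universalForm n d ∣ coeffComponent m (universalForm n d * h) := by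
  rw [universalForm, Finset.sum_mul, coeffComponent_sum]
  rcases m with _ | m
  · rw [Finset.sum_eq_zero fun I _ => coeffComponent_zero_monomial_mul _ (isHomogeneous_X _ _) _]
    exact dvd_zero _
  · refine ⟨coeffComponent m h, ?_⟩
    rw [Finset.sum_mul]
    refine Finset.sum_congr rfl fun I _ => ?_
    rw [add_comm m 1, coeffComponent_monomial_mul _ _ _ (isHomogeneous_X _ _)]

/-- A form of degree `k` defines a section of `𝒪(k)` over the universal hypersurface. -/
noncomputable def globalSection (n d k : ℕ) :
    homogeneousSubmodule (Fin (n + 1)) (BaseRing n d) k →ₗ[BaseRing n d] VerlindeModule n d k where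
  toFun g := ⟨fun i => toChart n d i (toUniversal n d g.1),
    fun i => ⟨0, g.1, g.2, fun _ => trivial, by simp⟩, fun i j => by
      rw [resLeft_toChart, resRight_toChart]⟩
  map_add' g h := by
    ext i
    simp
  map_smul' c g := by
    ext i
    simp only [SetLike.val_smul, RingHom.id_apply, Pi.smul_apply, smul_eq_C_mul, map_mul]
    rw [Algebra.smul_def,
      IsScalarTower.algebraMap_apply (BaseRing n d) (UniversalRing n d) (ChartRing n d i)]
    rfl

lemma globalSection_apply (g : homogeneousSubmodule (Fin (n + 1)) (BaseRing n d) k)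
    (i : Fin (n + 1)) : (globalSection n d k g).1 i = toChart n d i (toUniversal n d g.1) := rfl

lemma globalSection_eq_zero_iff (hn : 1 ≤ n)
    (g : homogeneousSubmodule (Fin (n + 1)) (BaseRing n d) k) :
    globalSection n d k g = 0 ↔ universalForm n d ∣ g.1 := by
  rw [← toUniversal_eq_zero]
  constructor
  · intro h
    refine toChart_injective hn 0 ?_
    rw [map_zero, ← globalSection_apply, h]
    rfl
  · intro h
    ext i
    rw [globalSection_apply, h, map_zero]
    rfl

lemma toUniversal_X_pow_mul (i : Fin (n + 1)) (a : ℕ) (g : BiRing n d) :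
    toUniversal n d (X i ^ a * g) = coord n d i ^ a * toUniversal n d g := by
  rw [map_mul, map_pow]; rfl

lemma exists_of_X_pow_mul_eq_of_isHomogeneous (hn : 2 ≤ n) {i j : Fin (n + 1)} (hij : i ≠ j)
    (a b : ℕ) {g h : BiRing n d} (hg : g.IsHomogeneous (k + a))
    (e : toUniversal n d (X j ^ b * g) = toUniversal n d (X i ^ a * h)) :
    ∃ p : BiRing n d, p.IsHomogeneous k ∧
      toUniversal n d g = toUniversal n d (X i ^ a * p) := by
  obtain ⟨u, hu⟩ := toUniversal_eq_iff.1 e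
  obtain ⟨p, q, hpq⟩ := exists_of_X_pow_mul_eq hn hij a b (g := g) (u := h) (h := u)
    (by rw [← hu]; ring)
  refine ⟨homogeneousComponent k p, homogeneousComponent_isHomogeneous _ _, ?_⟩
  have hpq' := congrArg (homogeneousComponent (a + k)) hpq
  rw [homogeneousComponent_eq_self (by rwa [add_comm a k]), map_add,
    homogeneousComponent_mul_of_isHomogeneous (isHomogeneous_X_pow i a)] at hpq'
  rw [toUniversal_eq_iff, hpq', add_sub_cancel_left]
  exact dvd_homogeneousComponent universalForm_isHomogeneous (dvd_mul_right _ _) _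

lemma toChart_mul_coord_pow_injective (i : Fin (n + 1)) (a : ℕ) {s t : ChartRing n d i}
    (h : s * toChart n d i (coord n d i) ^ a = t * toChart n d i (coord n d i) ^ a) : s = t :=
  ((isUnit_toChart_coord i).pow a).mul_right_cancel h

/-- Agreement on an overlap, with denominators cleared, descends to the coordinate ring because `x_i
x_j` is a nonzerodivisor there. -/
lemma toUniversal_eq_of_resLeft_eq_resRight (hn : 1 ≤ n) {i j : Fin (n + 1)} {a b : ℕ}
    {s : ChartRing n d i} {t : ChartRing n d j} {y z : UniversalRing n d}
    (h : resLeft n d i j s = resRight n d i j t)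
    (hs : s * toChart n d i (coord n d i) ^ a = toChart n d i y)
    (ht : t * toChart n d j (coord n d j) ^ b = toChart n d j z) :
    coord n d j ^ b * y = coord n d i ^ a * z := by
  apply toOverlap_injective hn i j
  have hs' := congrArg (resLeft n d i j) hs
  have ht' := congrArg (resRight n d i j) ht
  rw [map_mul, map_pow, resLeft_toChart, resLeft_toChart] at hs'
  rw [map_mul, map_pow, resRight_toChart, resRight_toChart] at ht'
  rw [map_mul, map_mul, map_pow, map_pow, ← hs', ← ht', h]
  ring

/-- Charts `0` and `1` suffice to find the form. From `g / x₀ ^ a = h / x₁ ^ b` one gets `x₁ ^ b g =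
x₀ ^ a h` modulo `F`, and regularity makes `g` divisible by `x₀ ^ a` modulo `F`. The quotient agrees
with the section on every other chart by gluing with chart `0`. -/
lemma globalSection_surjective (hn : 2 ≤ n) : Function.Surjective (globalSection n d k) := by
  intro s
  obtain ⟨a, g, hg, -, hs⟩ := s.2.1 0
  obtain ⟨b, h, -, -, ht⟩ := s.2.1 1
  have h01 : (0 : Fin (n + 1)) ≠ 1 := by
    rw [Ne, Fin.ext_iff, Fin.val_zero, Fin.val_one', Nat.mod_eq_of_lt (by omega)]
    omega
  obtain ⟨p, hp, hgp⟩ := exists_of_X_pow_mul_eq_of_isHomogeneous hn h01 a b hg (h := h) (by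
    rw [toUniversal_X_pow_mul, toUniversal_X_pow_mul]
    exact toUniversal_eq_of_resLeft_eq_resRight (by omega) (s.2.2 0 1) hs ht)
  have hs0 : s.1 0 = toChart n d 0 (toUniversal n d p) := by
    refine toChart_mul_coord_pow_injective 0 a ?_
    rw [hs, hgp, toUniversal_X_pow_mul, map_mul, map_pow, mul_comm]
  refine ⟨⟨p, hp⟩, Subtype.ext (funext fun j => ?_)⟩
  obtain ⟨b, h, -, -, ht⟩ := s.2.1 j
  have e := toUniversal_eq_of_resLeft_eq_resRight (by omega) (s.2.2 0 j) (a := 0)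
    (by rw [pow_zero, mul_one, hs0]) ht
  rw [globalSection_apply]
  refine toChart_mul_coord_pow_injective j b ?_
  rw [ht, ← map_pow, ← map_mul, mul_comm, e, pow_zero, one_mul]

/-- Any representing form may be replaced by its part of degree `m` in `α`: on chart `0` the section
is a fraction with numerator of degree `m`, and the ideal `(F)` is homogeneous in `α`. -/
lemma exists_of_mem_verlindeDegree (hn : 2 ≤ n) {m : ℕ} {s : VerlindeModule n d k}
    (hs : s ∈ verlindeDegree n d k m) :
    ∃ g, globalSection n d k g = s ∧ ∀ v, (g.1.coeff v).IsHomogeneous m := by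
  obtain ⟨g, rfl⟩ := globalSection_surjective hn s
  obtain ⟨a, h, hh, hhm, e⟩ := hs 0
  refine ⟨⟨coeffComponent m g.1, coeffComponent_isHomogeneous m g.2⟩, ?_, fun v => ?_⟩
  · rw [← sub_eq_zero, ← map_sub, globalSection_eq_zero_iff (by omega)]
    rw [globalSection_apply, ← map_pow, ← map_mul, (toChart_injective (by omega) 0).eq_iff,
      mul_comm, ← toUniversal_X_pow_mul, toUniversal_eq_iff] at e
    obtain ⟨u, hu⟩ := e
    have := exists_coeffComponent_universalForm_mul m u
    rw [← hu, coeffComponent_sub, X_pow_eq_monomial] at this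
    have h1 := coeffComponent_monomial_mul m 0 (Finsupp.single 0 a)
      (isHomogeneous_one (Mon n d) ℂ) g.1
    rw [zero_add] at h1
    have h2 : coeffComponent m h = h := by
      ext1 v
      rw [coeff_coeffComponent, homogeneousComponent_eq_self (hhm v)]
    rw [h1, h2, ← X_pow_eq_monomial] at this
    refine universalForm_dvd_of_dvd_X_pow_mul (by omega) 0 a ?_
    -- Both `x₀ ^ a g` and `x₀ ^ a g_m` are congruent to `h` modulo `F`, where `g_m` is the degree
    -- `m` part of `g`.
    have h3 := dvd_sub this (Dvd.intro _ hu.symm)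
    convert h3 using 1
    simp only [Submodule.coe_sub]
    ring
  · rw [coeff_coeffComponent]
    exact homogeneousComponent_isHomogeneous _ _

lemma globalSection_mem_verlindeDegree {m : ℕ}
    {g : homogeneousSubmodule (Fin (n + 1)) (BaseRing n d) k}
    (hg : ∀ v, (g.1.coeff v).IsHomogeneous m) :
    globalSection n d k g ∈ verlindeDegree n d k m := fun i =>
  ⟨0, g.1, g.2, hg, by simp [globalSection_apply]⟩

end GlobalSections

/-! ### The restriction to the line as forms over `ℂ[s, t]` modulo `s f₁ + t f₂` -/

section LineModule

variable {n : ℕ} {d k : ℕ} {f₁ f₂ : MvPolynomial (Fin (n + 1)) ℂ}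

namespace LineModule

lemma tmul_add (p : LineRing) (s t : VerlindeModule n d k) :
    tmul d k f₁ f₂ p (s + t) = tmul d k f₁ f₂ p s + tmul d k f₁ f₂ p t :=
  letI := (restrictToLine d f₁ f₂).toAlgebra
  TensorProduct.tmul_add p s t

lemma smul_tmul (p q : LineRing) (s : VerlindeModule n d k) :
    p • tmul d k f₁ f₂ q s = tmul d k f₁ f₂ (p * q) s :=
  letI := (restrictToLine d f₁ f₂).toAlgebra
  TensorProduct.smul_tmul' p q s

lemma tmul_smul (p : LineRing) (c : BaseRing n d) (s : VerlindeModule n d k) :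
    tmul d k f₁ f₂ p (c • s) = restrictToLine d f₁ f₂ c • tmul d k f₁ f₂ p s := by
  let := (restrictToLine d f₁ f₂).toAlgebra
  exact (TensorProduct.tmul_smul c p s).trans
    (algebraMap_smul LineRing c (TensorProduct.tmul (BaseRing n d) p s)).symm

lemma tmul_zero (p : LineRing) : tmul d k f₁ f₂ p (0 : VerlindeModule n d k) = 0 :=
  letI := (restrictToLine d f₁ f₂).toAlgebra
  TensorProduct.tmul_zero _ p

lemma induction_on {motive : LineModule d k f₁ f₂ → Prop} (y : LineModule d k f₁ f₂)
    (zero : motive 0) (tmul : ∀ p s, motive (tmul d k f₁ f₂ p s))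
    (add : ∀ y z, motive y → motive z → motive (y + z)) : motive y :=
  letI := (restrictToLine d f₁ f₂).toAlgebra
  TensorProduct.induction_on y zero tmul add

lemma exists_lift {A : Type*} [AddCommGroup A] [Module LineRing A]
    (φ : VerlindeModule n d k →+ A) (hφ : ∀ c s, φ (c • s) = restrictToLine d f₁ f₂ c • φ s) :
    ∃ Ψ : LineModule d k f₁ f₂ →ₗ[LineRing] A, ∀ p s, Ψ (tmul d k f₁ f₂ p s) = p • φ s := by
  let := (restrictToLine d f₁ f₂).toAlgebra
  let : Module (BaseRing n d) A := Module.compHom A (restrictToLine d f₁ f₂)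
  have : IsScalarTower (BaseRing n d) LineRing A := ⟨fun c p a => mul_smul _ _ _⟩
  let φ' : VerlindeModule n d k →ₗ[BaseRing n d] A := { φ with map_smul' := hφ }
  exact ⟨φ'.liftBaseChange LineRing, fun p s => LinearMap.liftBaseChange_tmul _ _ _ _⟩

end LineModule

/-- The equation `s f₁ + t f₂` of the universal hypersurface over the line `T`. -/
noncomputable def lineForm (f₁ f₂ : MvPolynomial (Fin (n + 1)) ℂ) :
    MvPolynomial (Fin (n + 1)) LineRing :=
  C (X 0) * map C f₁ + C (X 1) * map C f₂

lemma map_restrictToLine_universalForm (hf₁ : f₁.IsHomogeneous d) (hf₂ : f₂.IsHomogeneous d) :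
    map (restrictToLine d f₁ f₂) (universalForm n d) = lineForm f₁ f₂ := by
  classical
  ext1 v
  rw [universalForm, map_sum, coeff_sum, lineForm, coeff_add, coeff_C_mul, coeff_C_mul, coeff_map,
    coeff_map]
  simp only [map_monomial, coeff_monomial]
  by_cases hv : v ∈ (Finset.univ : Finset (Fin (n + 1))).finsuppAntidiag d
  · rw [Finset.sum_eq_single ⟨v, hv⟩]
    · rw [if_pos rfl, restrictToLine, AlgHom.toRingHom_eq_coe, RingHom.coe_coe, aeval_X]
      ring
    · intro I _ hI
      exact if_neg fun h => hI (Subtype.ext h)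
    · simp
  · have hdeg : v.degree ≠ d := fun h => hv (by
      rw [Finset.mem_finsuppAntidiag]
      exact ⟨by rw [← h, Finsupp.degree_eq_sum], Finset.subset_univ _⟩)
    rw [hf₁.coeff_eq_zero hdeg, hf₂.coeff_eq_zero hdeg, Finset.sum_eq_zero]
    · simp
    · intro I _
      exact if_neg fun h : I.1 = v => hv (h ▸ I.2)

lemma lineForm_isHomogeneous (hf₁ : f₁.IsHomogeneous d) (hf₂ : f₂.IsHomogeneous d) :
    (lineForm f₁ f₂).IsHomogeneous d :=
  ((hf₁.map C).C_mul _).add ((hf₂.map C).C_mul _)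

/-- The monomial `x ^ v` as a section of `𝒪(k)`, and zero if its degree is not `k`. -/
noncomputable def monomialSection (n d k : ℕ) (v : Fin (n + 1) →₀ ℕ) : VerlindeModule n d k :=
  open Classical in
  if h : v.degree = k then globalSection n d k ⟨monomial v 1, isHomogeneous_monomial _ h⟩ else 0

/-- The class in `LineModule` of the part of degree `k` of a polynomial. -/
noncomputable def lineClass (d k : ℕ) (f₁ f₂ : MvPolynomial (Fin (n + 1)) ℂ) :
    MvPolynomial (Fin (n + 1)) LineRing →ₗ[LineRing] LineModule d k f₁ f₂ :=
  (basisMonomials (Fin (n + 1)) LineRing).constr LineRing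
    fun v => LineModule.tmul d k f₁ f₂ 1 (monomialSection n d k v)

lemma lineClass_monomial (v : Fin (n + 1) →₀ ℕ) (r : LineRing) :
    lineClass d k f₁ f₂ (monomial v r) =
      LineModule.tmul d k f₁ f₂ r (monomialSection n d k v) := by
  have h : (monomial v r : MvPolynomial (Fin (n + 1)) LineRing) =
      r • basisMonomials (Fin (n + 1)) LineRing v := by simp [smul_monomial]
  rw [h, map_smul, lineClass, Module.Basis.constr_basis, LineModule.smul_tmul, mul_one]

lemma lineClass_map (g : homogeneousSubmodule (Fin (n + 1)) (BaseRing n d) k) :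
    lineClass d k f₁ f₂ (map (restrictToLine d f₁ f₂) g.1) =
      LineModule.tmul d k f₁ f₂ 1 (globalSection n d k g) := by
  let T : VerlindeModule n d k →+ LineModule d k f₁ f₂ :=
    AddMonoidHom.mk' (LineModule.tmul d k f₁ f₂ 1) (LineModule.tmul_add 1)
  have hg : globalSection n d k g =
      ∑ v ∈ g.1.support, g.1.coeff v • monomialSection n d k v := by
    have : g = ∑ v ∈ g.1.support.attach, g.1.coeff v.1 •
        (⟨monomial v.1 1, isHomogeneous_monomial _
          (by rw [Finsupp.degree_apply]; exact (g.2.degree_eq_sum_deg_support v.2).symm)⟩ :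
          homogeneousSubmodule (Fin (n + 1)) (BaseRing n d) k) := by
      ext1
      simp only [AddSubmonoidClass.coe_finsetSum, SetLike.val_smul, smul_monomial, smul_eq_mul,
        mul_one]
      conv_lhs => rw [g.1.as_sum]
      exact (Finset.sum_attach g.1.support fun v =>
        (monomial v (g.1.coeff v) : BiRing n d)).symm
    conv_lhs => rw [this]
    rw [map_sum, ← Finset.sum_attach g.1.support
      fun v => g.1.coeff v • monomialSection n d k v]
    refine Finset.sum_congr rfl fun v _ => ?_
    have hv : v.1.degree = k := by
      rw [Finsupp.degree_apply]; exact (g.2.degree_eq_sum_deg_support v.2).symm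
    rw [map_smul, monomialSection, dif_pos hv]
  rw [hg]
  change _ = T _
  rw [map_sum]
  conv_lhs => rw [g.1.as_sum, map_sum, map_sum]
  refine Finset.sum_congr rfl fun v _ => ?_
  change _ = LineModule.tmul d k f₁ f₂ 1 _
  rw [LineModule.tmul_smul, LineModule.smul_tmul, mul_one, map_monomial, lineClass_monomial]

/-- The map `Ψ` detects vanishing in the tensor product: it shows that base change creates no
relations beyond multiples of `s f₁ + t f₂`. It exists because restriction sends `F` to that form.
-/
lemma exists_section_mk (hn : 2 ≤ n) (hf₁ : f₁.IsHomogeneous d) (hf₂ : f₂.IsHomogeneous d) :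
    ∃ Ψ : LineModule d k f₁ f₂ →ₗ[LineRing]
        MvPolynomial (Fin (n + 1)) LineRing ⧸ Ideal.span {lineForm f₁ f₂},
      ∀ P : MvPolynomial (Fin (n + 1)) LineRing, P.IsHomogeneous k →
        Ψ (lineClass d k f₁ f₂ P) = Ideal.Quotient.mk _ P := by
  let π := (Ideal.Quotient.mk (Ideal.span {lineForm f₁ f₂})).comp (map (restrictToLine d f₁ f₂))
  have hπ : ∀ g h : homogeneousSubmodule (Fin (n + 1)) (BaseRing n d) k,
      globalSection n d k g = globalSection n d k h → π g.1 = π h.1 := by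
    intro g h e
    rw [← sub_eq_zero, ← map_sub, globalSection_eq_zero_iff (by omega)] at e
    obtain ⟨u, hu⟩ := e
    rw [← sub_eq_zero, ← map_sub]
    change π (g - h).1 = 0
    rw [hu]
    simp only [π, RingHom.comp_apply, map_mul, map_restrictToLine_universalForm hf₁ hf₂]
    rw [Ideal.Quotient.eq_zero_iff_mem.2 (Ideal.mem_span_singleton_self _), zero_mul]
  have hsmul : ∀ (r : LineRing) (P : MvPolynomial (Fin (n + 1)) LineRing),
      r • Ideal.Quotient.mk (Ideal.span {lineForm f₁ f₂}) P = Ideal.Quotient.mk _ (C r * P) := by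
    intro r P
    rw [← smul_eq_C_mul]
    rfl
  -- An arbitrary choice of representing forms; `hπ` makes their classes independent of it, hence
  -- additive and semilinear.
  let sec := Function.surjInv (globalSection_surjective (d := d) (k := k) hn)
  have hsec : ∀ s, globalSection n d k (sec s) = s := Function.surjInv_eq _
  let φ : VerlindeModule n d k →+ MvPolynomial (Fin (n + 1)) LineRing ⧸
      Ideal.span {lineForm f₁ f₂} :=
    AddMonoidHom.mk' (fun s => π (sec s).1) fun s t => by
      rw [← map_add]
      exact hπ (sec (s + t)) (sec s + sec t) (by rw [map_add, hsec, hsec, hsec])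
  have hφg : ∀ g, φ (globalSection n d k g) = π g.1 := fun g => hπ _ _ (hsec _)
  obtain ⟨Ψ, hΨ⟩ := LineModule.exists_lift (f₁ := f₁) (f₂ := f₂) φ (fun c s => by
    obtain ⟨g, rfl⟩ := globalSection_surjective hn s
    rw [← map_smul, hφg, hφg, SetLike.val_smul, smul_eq_C_mul]
    simp only [π, RingHom.comp_apply]
    rw [hsmul, map_mul, map_C])
  refine ⟨Ψ, fun P hP => ?_⟩
  conv_lhs => rw [P.as_sum]
  conv_rhs => rw [P.as_sum]
  rw [map_sum, map_sum, map_sum]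
  refine Finset.sum_congr rfl fun v hv => ?_
  have hv : v.degree = k := by
    rw [Finsupp.degree_apply]; exact (hP.degree_eq_sum_deg_support hv).symm
  rw [lineClass_monomial, hΨ, monomialSection, dif_pos hv, hφg]
  simp only [π, RingHom.comp_apply]
  rw [hsmul, map_monomial, map_one, C_mul_monomial, mul_one]

/-- One direction applies the detecting map `Ψ` and then counts degrees, `k = d + 1` making the
cofactor linear. Conversely `(s f₁ + t f₂) x ^ v` is the restriction of `F x ^ v`, which is the zero
section. -/
lemma lineClass_eq_zero_iff (hn : 2 ≤ n) (hk : k = d + 1) (hf₁ : f₁.IsHomogeneous d)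
    (hf₂ : f₂.IsHomogeneous d) {P : MvPolynomial (Fin (n + 1)) LineRing} (hP : P.IsHomogeneous k) :
    lineClass d k f₁ f₂ P = 0 ↔
      ∃ l : MvPolynomial (Fin (n + 1)) LineRing, l.IsHomogeneous 1 ∧ P = lineForm f₁ f₂ * l := by
  constructor
  · intro h
    obtain ⟨Ψ, hΨ⟩ := exists_section_mk (k := k) hn hf₁ hf₂
    have := hΨ P hP
    rw [h, map_zero, eq_comm, Ideal.Quotient.eq_zero_iff_mem, Ideal.mem_span_singleton] at this
    exact exists_isHomogeneous_of_dvd (lineForm_isHomogeneous hf₁ hf₂) (hk ▸ hP) this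
  · rintro ⟨l, hl, rfl⟩
    rw [l.as_sum, Finset.mul_sum, map_sum]
    refine Finset.sum_eq_zero fun v hv => ?_
    have hv : v.degree = 1 := by
      rw [Finsupp.degree_apply]; exact (hl.degree_eq_sum_deg_support hv).symm
    let g : homogeneousSubmodule (Fin (n + 1)) (BaseRing n d) k :=
      ⟨universalForm n d * monomial v 1, by
        rw [hk]
        exact universalForm_isHomogeneous.mul (isHomogeneous_monomial _ hv)⟩
    have h1 : lineForm f₁ f₂ * monomial v (l.coeff v) =
        l.coeff v • map (restrictToLine d f₁ f₂) g.1 := by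
      simp only [g, map_mul, map_restrictToLine_universalForm hf₁ hf₂, map_monomial, map_one,
        smul_eq_C_mul]
      rw [← mul_assoc, mul_comm (C _), mul_assoc, C_mul_monomial, mul_one]
    rw [h1, map_smul, lineClass_map,
      (globalSection_eq_zero_iff (by omega) g).2 (dvd_mul_right _ _), LineModule.tmul_zero,
      smul_zero]

lemma map_isHomogeneous_of_restrictToLine {m : ℕ} {c : BaseRing n d} (hc : c.IsHomogeneous m) :
    (restrictToLine d f₁ f₂ c).IsHomogeneous m := by
  have := hc.aeval (fun I : Mon n d =>
    (C (f₁.coeff I) * X 0 + C (f₂.coeff I) * X 1 : LineRing)) (n := 1) fun I =>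
    (isHomogeneous_C_mul_X _ _).add (isHomogeneous_C_mul_X _ _)
  rwa [one_mul] at this

lemma mem_lineDegree_iff (hn : 2 ≤ n) {m : ℕ} {y : LineModule d k f₁ f₂} :
    y ∈ lineDegree d k f₁ f₂ m ↔ ∃ P : MvPolynomial (Fin (n + 1)) LineRing,
      P.IsHomogeneous k ∧ (∀ v, (P.coeff v).IsHomogeneous m) ∧ lineClass d k f₁ f₂ P = y := by
  constructor
  · intro hy
    induction hy using AddSubgroup.closure_induction with
    | mem y hy =>
      obtain ⟨a, b, p, s, hab, hp, hs, rfl⟩ := hy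
      obtain ⟨g, rfl, hg⟩ := exists_of_mem_verlindeDegree hn hs
      refine ⟨C p * map (restrictToLine d f₁ f₂) g.1, ?_, fun v => ?_, ?_⟩
      · exact (IsHomogeneous.map g.2 _).C_mul _
      · rw [coeff_C_mul, coeff_map, ← hab]
        exact hp.mul (map_isHomogeneous_of_restrictToLine (hg v))
      · rw [← smul_eq_C_mul, map_smul, lineClass_map, LineModule.smul_tmul, mul_one]
    | zero => exact ⟨0, isHomogeneous_zero _ _ _, fun v => by simpa using isHomogeneous_zero _ _ _,
        map_zero _⟩
    | add y z _ _ hy hz =>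
      obtain ⟨P, hP, hPm, rfl⟩ := hy
      obtain ⟨Q, hQ, hQm, rfl⟩ := hz
      exact ⟨P + Q, hP.add hQ, fun v => by rw [coeff_add]; exact (hPm v).add (hQm v), map_add _ _ _⟩
    | neg y _ hy =>
      obtain ⟨P, hP, hPm, rfl⟩ := hy
      exact ⟨-P, hP.neg, fun v => by rw [coeff_neg]; exact (hPm v).neg, map_neg _ _⟩
  · rintro ⟨P, hP, hPm, rfl⟩
    rw [P.as_sum, map_sum]
    refine sum_mem fun v hv => AddSubgroup.subset_closure ?_
    rw [lineClass_monomial]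
    refine ⟨m, 0, P.coeff v, _, add_zero m, hPm v, ?_, rfl⟩
    have hv : v.degree = k := by
      rw [Finsupp.degree_apply]; exact (hP.degree_eq_sum_deg_support hv).symm
    rw [monomialSection, dif_pos hv]
    refine globalSection_mem_verlindeDegree fun w => ?_
    classical
    rw [coeff_monomial]
    split_ifs
    · exact isHomogeneous_one _ _
    · exact isHomogeneous_zero _ _ _

lemma exists_lineClass_eq (hn : 2 ≤ n) (y : LineModule d k f₁ f₂) :
    ∃ P : MvPolynomial (Fin (n + 1)) LineRing, P.IsHomogeneous k ∧
      lineClass d k f₁ f₂ P = y := by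
  induction y using LineModule.induction_on with
  | zero => exact ⟨0, isHomogeneous_zero _ _ _, map_zero _⟩
  | tmul p s =>
    obtain ⟨g, rfl⟩ := globalSection_surjective hn s
    refine ⟨C p * map (restrictToLine d f₁ f₂) g.1, (IsHomogeneous.map g.2 _).C_mul _, ?_⟩
    rw [← smul_eq_C_mul, map_smul, lineClass_map, LineModule.smul_tmul, mul_one]
  | add y z hy hz =>
    obtain ⟨P, hP, rfl⟩ := hy
    obtain ⟨Q, hQ, rfl⟩ := hz
    exact ⟨P + Q, hP.add hQ, map_add _ _ _⟩

end LineModule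

/-! ### Criteria for isomorphism of sheaves on `ℙ¹` -/

section SheafIso

/-- Localization preserves injectivity, and every element of the cokernel is killed by a power of
each coordinate, so `ψ` becomes bijective on both charts. Agreement on the overlap is automatic,
since both chart maps come from `ψ`. -/
lemma sheafIso_of_injective {M N : Type*} [AddCommGroup M] [Module LineRing M] [AddCommGroup N]
    [Module LineRing N] {degM : ℕ → AddSubgroup M} {degN : ℕ → AddSubgroup N}
    (ψ : M →ₗ[LineRing] N) (hinj : Function.Injective ψ)
    (hdeg : ∀ m, ∀ x ∈ degM m, ψ x ∈ degN m)
    (hsurj : ∀ (i : Fin 2) (y : N), ∃ (c : ℕ) (x : M), ψ x = (X i : LineRing) ^ c • y)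
    (hsurj_deg : ∀ (i : Fin 2) (m : ℕ), ∀ y ∈ degN m, ∃ c : ℕ, ∃ x ∈ degM (m + c),
      ψ x = (X i : LineRing) ^ c • y) : SheafIso degM degN := by
  let Φ : ∀ i : Fin 2, LocalizedModule (Submonoid.powers (X i : LineRing)) M →ₗ[LineRing]
      LocalizedModule (Submonoid.powers (X i : LineRing)) N := fun i =>
    IsLocalizedModule.map (Submonoid.powers (X i : LineRing)) (LocalizedModule.mkLinearMap _ M)
      (LocalizedModule.mkLinearMap _ N) ψ
  have hΦ : ∀ i x s, Φ i (LocalizedModule.mk x s) = LocalizedModule.mk (ψ x) s := fun i x s =>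
    IsLocalizedModule.map_LocalizedModules _ _ _ _
  have hmk : ∀ (i : Fin 2) (y : N) (c a : ℕ),
      LocalizedModule.mk ((X i : LineRing) ^ c • y) (Submonoid.pow (X i : LineRing) (a + c)) =
        LocalizedModule.mk y (Submonoid.pow (X i : LineRing) a) := by
    intro i y c a
    rw [LocalizedModule.mk_eq]
    refine ⟨1, ?_⟩
    simp only [one_smul, Submonoid.smul_def, Submonoid.pow_apply]
    rw [smul_smul, ← pow_add]
  have hbij : ∀ i, Function.Bijective (Φ i) := fun i => by
    refine ⟨IsLocalizedModule.map_injective _ _ _ _ hinj, fun y => ?_⟩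
    induction y using LocalizedModule.induction_on with
    | h y s =>
      obtain ⟨c, x, hx⟩ := hsurj i y
      obtain ⟨a, ha⟩ := (Submonoid.mem_powers_iff _ _).1 s.2
      obtain rfl : s = Submonoid.pow (X i : LineRing) a := Subtype.ext ha.symm
      exact ⟨LocalizedModule.mk x (Submonoid.pow _ (a + c)), by rw [hΦ, hx, hmk]⟩
  refine ⟨fun i => LinearEquiv.ofBijective (Φ i) (hbij i), fun i y => ⟨?_, ?_⟩, fun x => ?_⟩
  · rintro ⟨a, p, hp, e⟩
    obtain ⟨c, x, hx, hxp⟩ := hsurj_deg i a p hp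
    refine ⟨a + c, x, hx, (hbij i).1 ?_⟩
    rw [hΦ, hxp, hmk]
    exact e
  · rintro ⟨a, p, hp, rfl⟩
    exact ⟨a, ψ p, hdeg a p hp, hΦ _ _ _⟩
  · simp only [LinearEquiv.ofBijective_apply, hΦ]
    exact (IsLocalizedModule.liftOfLE_apply _ _ _ _ _ (ψ x)).trans
      (IsLocalizedModule.liftOfLE_apply _ _ _ _ _ (ψ x)).symm

lemma powers_X_sup_le_nonZeroDivisors :
    Submonoid.powers (X 0 : LineRing) ⊔ Submonoid.powers (X 1 : LineRing) ≤
      nonZeroDivisors LineRing :=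
  sup_le (Submonoid.powers_le.2 (mem_nonZeroDivisors_of_ne_zero (X_ne_zero _)))
    (Submonoid.powers_le.2 (mem_nonZeroDivisors_of_ne_zero (X_ne_zero _)))

lemma localizedModule_mk_eq_zero_iff {ι : Type*} {S : Submonoid LineRing}
    (hS : S ≤ nonZeroDivisors LineRing) {q : ι → LineRing} {s : S} :
    LocalizedModule.mk q s = 0 ↔ q = 0 := by
  constructor
  · intro h
    rw [← LocalizedModule.zero_mk s, LocalizedModule.mk_eq] at h
    obtain ⟨c, hc⟩ := h
    simp only [Submonoid.smul_def, smul_zero] at hc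
    funext j
    have h0 : ∀ t : S, (t : LineRing) ≠ 0 := fun t => nonZeroDivisors.ne_zero (hS t.2)
    simpa [h0] using congrFun hc j
  · rintro rfl
    exact LocalizedModule.zero_mk s

lemma liftOfLE_injective {ι : Type*} {S T : Submonoid LineRing} (h : S ≤ T)
    (hT : T ≤ nonZeroDivisors LineRing) :
    Function.Injective (LocalizedModule.liftOfLE S T h (M := ι → LineRing)) := by
  rw [injective_iff_map_eq_zero]
  intro y hy
  induction y using LocalizedModule.induction_on with
  | h q s =>
    rw [IsLocalizedModule.mk_eq_mk', LocalizedModule.liftOfLE, IsLocalizedModule.liftOfLE_mk',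
      ← IsLocalizedModule.mk_eq_mk', localizedModule_mk_eq_zero_iff hT] at hy
    rw [hy, LocalizedModule.zero_mk]

lemma X_pow_dvd_of_mul_eq {a b : ℕ} {p q : LineRing}
    (h : (X 1 : LineRing) ^ b * p = (X 0 : LineRing) ^ a * q) : (X 0 : LineRing) ^ a ∣ p := by
  have hdvd : (X 0 : LineRing) ^ a ∣ (X 1 : LineRing) ^ b * p := ⟨q, h⟩
  refine (X_prime (R := ℂ) (i := (0 : Fin 2))).pow_dvd_of_dvd_mul_left a (fun h => ?_) hdvd
  have := (X_prime (R := ℂ) (i := (0 : Fin 2))).dvd_of_dvd_pow h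
  exact absurd (X_dvd_X.1 this) (by decide)

/-- A summand `𝒪(2)` would map nontrivially to a sum of copies of `𝒪(1)`. Concretely, its generator
yields `p` of degree `a` such that `X 0 ^ (a + 2)` divides every coordinate of `ψ p`. These have
degree at most `a + 1`, so `p = 0`. -/
lemma not_sheafIso_twistDegree {M : Type*} [AddCommGroup M] [Module LineRing M]
    {degM : ℕ → AddSubgroup M} {ι : Type*} (ψ : M →ₗ[LineRing] ι → LineRing)
    (hinj : Function.Injective ψ)
    (hdeg : ∀ m, ∀ x ∈ degM m, ∀ j, (ψ x j).totalDegree ≤ m + 1)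
    {r : ℕ} {b : Fin r → ℤ} {j₀ : Fin r} (hb : b j₀ = 2) :
    ¬ SheafIso degM (twistDegree b) := by
  classical
  rintro ⟨Φ, hΦ, hoverlap⟩
  set e₀ : Fin r → LineRing := Pi.single j₀ 1
  -- The element `z ^ 2 • e₀` is a section of the summand `𝒪(2)`; its preimage on the chart is a
  -- fraction `p / z ^ a`, whose denominator is then cleared.
  have key : ∀ i : Fin 2, ∃ (a : ℕ) (p : M), p ∈ degM a ∧
      Φ i (LocalizedModule.mk p 1) = LocalizedModule.mk ((X i : LineRing) ^ (a + 2) • e₀) 1 := by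
    intro i
    obtain ⟨y, hy⟩ := (Φ i).surjective (LocalizedModule.mk ((X i : LineRing) ^ 2 • e₀) 1)
    obtain ⟨a, p, hp, rfl⟩ := (hΦ i y).1 <| by
      rw [hy]
      refine ⟨0, _, fun j v hv => ?_, by congr 1⟩
      rcases eq_or_ne j j₀ with rfl | hj
      · have hv : v ∈ ((X i : LineRing) ^ 2).support := by simpa [e₀] using hv
        rw [X_pow_eq_monomial] at hv
        have := Finset.mem_singleton.1 (support_monomial_subset hv)
        simp [this, hb]
      · simp [e₀, hj] at hv
    refine ⟨a, p, hp, ?_⟩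
    have h1 : (LocalizedModule.mk p 1 : LocalizedModule (Submonoid.powers (X i : LineRing)) M) =
        (X i : LineRing) ^ a • LocalizedModule.mk p (Submonoid.pow (X i : LineRing) a) := by
      rw [LocalizedModule.smul'_mk]
      exact (LocalizedModule.mk_cancel (Submonoid.pow (X i : LineRing) a) p).symm
    rw [h1, map_smul, hy, LocalizedModule.smul'_mk, smul_smul, ← pow_add]
  obtain ⟨a, p, hp, hpe⟩ := key 0
  obtain ⟨a', p', hp', hpe'⟩ := key 1
  have hlift : ∀ (i : Fin 2) (h : Submonoid.powers (X i : LineRing) ≤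
      Submonoid.powers (X 0 : LineRing) ⊔ Submonoid.powers (X 1 : LineRing)) (q : Fin r → LineRing),
      LocalizedModule.liftOfLE _ _ h (LocalizedModule.mk q 1) = LocalizedModule.mk q 1 :=
    fun i h q => IsLocalizedModule.liftOfLE_apply _ _ _ _ _ q
  have h0 := hoverlap p
  rw [hpe, hlift] at h0
  -- On the overlap both sides equal `X 0 ^ (a + 2) * X 1 ^ (a' + 2)` times `e₀`.
  have h1 : Φ 1 (LocalizedModule.mk ((X 1 : LineRing) ^ (a' + 2) • p) 1) =
      Φ 1 (LocalizedModule.mk ((X 0 : LineRing) ^ (a + 2) • p') 1) := by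
    refine liftOfLE_injective le_sup_right powers_X_sup_le_nonZeroDivisors ?_
    simp only [← LocalizedModule.smul'_mk, map_smul]
    rw [← h0, hpe', hlift]
    simp only [LocalizedModule.smul'_mk, smul_smul]
    rw [mul_comm]
  have h2 := (Φ 1).injective h1
  rw [LocalizedModule.mk_eq] at h2
  obtain ⟨c, hc⟩ := h2
  have hp0 : p = 0 := by
    refine hinj ?_
    rw [map_zero]
    funext j
    have h3 := congrFun (congrArg ψ hc) j
    simp only [one_smul, Submonoid.smul_def, map_smul, Pi.smul_apply, smul_eq_mul] at h3
    have hc0 : (c : LineRing) ≠ 0 :=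
      nonZeroDivisors.ne_zero
        (powers_X_sup_le_nonZeroDivisors (le_sup_right (α := Submonoid _) c.2))
    obtain ⟨q, hq⟩ := X_pow_dvd_of_mul_eq (mul_left_cancel₀ hc0 h3)
    by_contra hne
    rw [Pi.zero_apply] at hne
    have hq0 : q ≠ 0 := by rintro rfl; simp [hq] at hne
    have := hdeg a p hp j
    rw [hq, totalDegree_mul_of_isDomain (pow_ne_zero _ (X_ne_zero _)) hq0,
      totalDegree_X_pow] at this
    omega
  rw [hp0, LocalizedModule.zero_mk, map_zero, eq_comm, localizedModule_mk_eq_zero_iff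
    (le_sup_left.trans powers_X_sup_le_nonZeroDivisors)] at hpe
  have := congrFun hpe j₀
  simp [e₀] at this

end SheafIso

/-! ### Coordinates of forms over `ℂ[s, t]` in a complex basis -/

section Coordinates

variable {n k : ℕ} {ι : Type*} [Fintype ι]

/-- The form with coefficients in `ℂ[s, t]` whose coordinates with respect to a basis of the forms
of degree `k` over `ℂ` are given. -/
noncomputable def formOfCoords (u : ι → homogeneousSubmodule (Fin (n + 1)) ℂ k) :
    (ι → LineRing) →ₗ[LineRing] MvPolynomial (Fin (n + 1)) LineRing :=
  Fintype.linearCombination LineRing fun j => map C (u j).1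

lemma formOfCoords_apply (u : ι → homogeneousSubmodule (Fin (n + 1)) ℂ k) (c : ι → LineRing) :
    formOfCoords u c = ∑ j, c j • map (C : ℂ →+* LineRing) (u j).1 := rfl

lemma formOfCoords_isHomogeneous (u : ι → homogeneousSubmodule (Fin (n + 1)) ℂ k)
    (c : ι → LineRing) : (formOfCoords u c).IsHomogeneous k := by
  refine IsHomogeneous.sum _ _ _ fun j _ => ?_
  rw [smul_eq_C_mul]
  exact (IsHomogeneous.map (u j).2 _).C_mul _

lemma coeff_formOfCoords_isHomogeneous (u : ι → homogeneousSubmodule (Fin (n + 1)) ℂ k)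
    {c : ι → LineRing} {m : ℕ} (hc : ∀ j, (c j).IsHomogeneous m) (v : Fin (n + 1) →₀ ℕ) :
    ((formOfCoords u c).coeff v).IsHomogeneous m := by
  rw [formOfCoords_apply, coeff_sum]
  refine IsHomogeneous.sum _ _ _ fun j _ => ?_
  rw [coeff_smul, coeff_map, smul_eq_mul]
  exact (hc j).mul (isHomogeneous_C _ _)

/-- Comparing coefficients of each monomial in `s, t` reduces independence over `ℂ[s, t]` to
independence over `ℂ`. -/
lemma formOfCoords_injective {u : ι → homogeneousSubmodule (Fin (n + 1)) ℂ k}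
    (hu : LinearIndependent ℂ u) : Function.Injective (formOfCoords u) := by
  rw [injective_iff_map_eq_zero]
  intro c hc
  funext j
  ext1 e
  refine Fintype.linearIndependent_iff.1 hu (fun j => (c j).coeff e) (Subtype.ext ?_) j
  ext1 v
  have := congrArg (coeff e) (congrArg (coeff v) hc)
  rw [formOfCoords_apply, coeff_sum, coeff_sum] at this
  simp only [coeff_smul, coeff_map, smul_eq_mul, mul_comm (c _), coeff_C_mul, coeff_zero] at this
  simpa [AddSubmonoidClass.coe_finsetSum, coeff_sum, mul_comm] using this

lemma exists_formOfCoords_eq (u : Module.Basis ι ℂ (homogeneousSubmodule (Fin (n + 1)) ℂ k))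
    {P : MvPolynomial (Fin (n + 1)) LineRing} (hP : P.IsHomogeneous k) :
    ∃ c, formOfCoords u c = P ∧
      ∀ m, (∀ v, (P.coeff v).IsHomogeneous m) → ∀ j, (c j).IsHomogeneous m := by
  have hv : ∀ v ∈ P.support, v.degree = k := fun v hv => by
    rw [Finsupp.degree_apply]; exact (hP.degree_eq_sum_deg_support hv).symm
  let x : P.support → homogeneousSubmodule (Fin (n + 1)) ℂ k := fun v =>
    ⟨monomial v.1 1, isHomogeneous_monomial _ (hv v.1 v.2)⟩
  refine ⟨∑ v : P.support, fun j => P.coeff v.1 * C (u.repr (x v) j), ?_, fun m hm j => ?_⟩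
  · rw [map_sum]
    conv_rhs => rw [P.as_sum]
    rw [← Finset.sum_coe_sort P.support]
    refine Finset.sum_congr rfl fun v _ => ?_
    have h1 := congrArg (fun y => map (C : ℂ →+* LineRing) y.1) (u.sum_repr (x v))
    simp only [AddSubmonoidClass.coe_finsetSum, SetLike.val_smul, map_sum, smul_eq_C_mul, map_mul,
      map_C, x, map_monomial, map_one] at h1
    rw [formOfCoords_apply]
    simp only [mul_smul]
    rw [← Finset.smul_sum]
    simp only [smul_eq_C_mul]
    rw [h1, C_mul_monomial, mul_one]
  · rw [Finset.sum_apply]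
    exact IsHomogeneous.sum _ _ _ fun v _ => (hm v.1).mul (isHomogeneous_C _ _)

end Coordinates

/-! ### Maps out of the restricted bundle from its presentation -/

section Presentation

variable {n d k : ℕ} {f₁ f₂ : MvPolynomial (Fin (n + 1)) ℂ} {ι κ : Type*} [Fintype ι] [Fintype κ]

/-- A linear map out of the coordinate space whose kernel consists of the multiples of
`s f₁ + t f₂` factors through an injective map out of `LineModule`. -/
lemma exists_injective_of_ker_eq (hn : 2 ≤ n) (hk : k = d + 1) (hf₁ : f₁.IsHomogeneous d)
    (hf₂ : f₂.IsHomogeneous d)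
    (u : Module.Basis ι ℂ (homogeneousSubmodule (Fin (n + 1)) ℂ k))
    (w : Module.Basis κ ℂ (homogeneousSubmodule (Fin (n + 1)) ℂ 1))
    {N : Type*} [AddCommGroup N] [Module LineRing N] (φ : (ι → LineRing) →ₗ[LineRing] N)
    (hφ : ∀ c, φ c = 0 ↔ ∃ l, formOfCoords u c = lineForm f₁ f₂ * formOfCoords w l) :
    ∃ ψ : LineModule d k f₁ f₂ →ₗ[LineRing] N, Function.Injective ψ ∧
      (∀ c, ψ (lineClass d k f₁ f₂ (formOfCoords u c)) = φ c) := by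
  let ρ := (lineClass d k f₁ f₂).comp (formOfCoords u)
  have hρ : Function.Surjective ρ := fun y => by
    obtain ⟨P, hP, rfl⟩ := exists_lineClass_eq hn y
    obtain ⟨c, rfl, -⟩ := exists_formOfCoords_eq u hP
    exact ⟨c, rfl⟩
  have hker : LinearMap.ker ρ = LinearMap.ker φ := by
    ext c
    rw [LinearMap.mem_ker, LinearMap.mem_ker, hφ, LinearMap.comp_apply,
      lineClass_eq_zero_iff hn hk hf₁ hf₂ (formOfCoords_isHomogeneous _ _)]
    constructor
    · rintro ⟨l, hl, h⟩
      obtain ⟨c, rfl, -⟩ := exists_formOfCoords_eq w hl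
      exact ⟨c, h⟩
    · rintro ⟨l, h⟩
      exact ⟨_, formOfCoords_isHomogeneous _ _, h⟩
  let e := ρ.quotKerEquivOfSurjective hρ
  have he : ∀ c, e.symm (ρ c) = Submodule.Quotient.mk c := fun c => by
    rw [LinearEquiv.symm_apply_eq]
    rfl
  refine ⟨((LinearMap.ker ρ).liftQ φ hker.le).comp e.symm.toLinearMap, ?_, fun c => ?_⟩
  · rw [injective_iff_map_eq_zero]
    intro y hy
    obtain ⟨c, rfl⟩ := hρ y
    rw [LinearMap.comp_apply, LinearEquiv.coe_coe, he] at hy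
    exact LinearMap.mem_ker.1 (hker.ge hy)
  · rw [LinearMap.comp_apply, LinearEquiv.coe_coe]
    exact congrArg _ (he c)

lemma mem_lineDegree_iff_exists_coords (hn : 2 ≤ n)
    (u : Module.Basis ι ℂ (homogeneousSubmodule (Fin (n + 1)) ℂ k)) {m : ℕ}
    {y : LineModule d k f₁ f₂} :
    y ∈ lineDegree d k f₁ f₂ m ↔
      ∃ c, (∀ j, (c j).IsHomogeneous m) ∧ lineClass d k f₁ f₂ (formOfCoords u c) = y := by
  rw [mem_lineDegree_iff hn]
  constructor
  · rintro ⟨P, hP, hPm, rfl⟩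
    obtain ⟨c, rfl, hc⟩ := exists_formOfCoords_eq u hP
    exact ⟨c, hc m hPm, rfl⟩
  · rintro ⟨c, hc, rfl⟩
    exact ⟨_, formOfCoords_isHomogeneous _ _, coeff_formOfCoords_isHomogeneous _ hc, rfl⟩

lemma lineForm_mul_formOfCoords (w : κ → homogeneousSubmodule (Fin (n + 1)) ℂ 1)
    (l : κ → LineRing) :
    lineForm f₁ f₂ * formOfCoords w l =
      ∑ i, ((l i * X 0) • map (C : ℂ →+* LineRing) (f₁ * (w i).1) +
        (l i * X 1) • map (C : ℂ →+* LineRing) (f₂ * (w i).1)) := by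
  rw [formOfCoords_apply, Finset.mul_sum]
  refine Finset.sum_congr rfl fun i _ => ?_
  simp only [lineForm, smul_eq_C_mul, map_mul]
  ring

end Presentation

/-! ### Dimensions, factors and syzygies of forms -/

section Forms

lemma exists_basis_extending {K ι : Type*} {V : Type} [Field K] [AddCommGroup V] [Module K V]
    [FiniteDimensional K V] {v : ι → V} (hv : LinearIndependent K v) :
    ∃ (μ : Type) (_ : Fintype μ) (u : Module.Basis (ι ⊕ μ) K V), ∀ i, u (Sum.inl i) = v i := by
  let u := Module.Basis.sumExtend hv
  have : Fintype (ι ⊕ Module.Basis.sumExtendIndex hv) := FiniteDimensional.fintypeBasisIndex u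
  refine ⟨Module.Basis.sumExtendIndex hv, Fintype.sumRight (α := ι), u, fun i => ?_⟩
  simp only [u, Module.Basis.sumExtend, Equiv.trans_def, Module.Basis.coe_reindex,
    Function.comp_apply, Module.Basis.extend_apply_self]
  rfl

instance finite_homogeneousSubmodule {σ K : Type*} [Finite σ] [Field K] (k : ℕ) :
    Module.Finite K (homogeneousSubmodule σ K k) :=
  Module.Finite.iff_fg.2 (homogeneousSubmodule_fg _ _ k)

lemma finrank_homogeneousSubmodule {K : Type*} [Field K] (n k : ℕ) :
    Module.finrank K (homogeneousSubmodule (Fin (n + 1)) K k) = (k + n).choose n := by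
  have hdeg : ∀ v : Mon n k, (v : Fin (n + 1) →₀ ℕ).degree = k := fun v => by
    rw [Finsupp.degree_eq_sum]
    exact (Finset.mem_finsuppAntidiag.1 v.2).1
  let x : Mon n k → homogeneousSubmodule (Fin (n + 1)) K k := fun v =>
    ⟨monomial v.1 1, isHomogeneous_monomial _ (hdeg v)⟩
  have hx : LinearIndependent K x := by
    refine LinearIndependent.of_comp (Submodule.subtype _) ?_
    have := (basisMonomials (Fin (n + 1)) K).linearIndependent.comp
      (Subtype.val : Mon n k → _) Subtype.val_injective
    rw [coe_basisMonomials] at this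
    exact this
  have hspan : ⊤ ≤ Submodule.span K (Set.range x) := by
    rintro p -
    have hp : ∀ v ∈ p.1.support, v ∈ (Finset.univ : Finset (Fin (n + 1))).finsuppAntidiag k :=
      fun v hv => Finset.mem_finsuppAntidiag.2 ⟨by
        rw [p.2.degree_eq_sum_deg_support hv, ← Finsupp.degree_apply, Finsupp.degree_eq_sum],
        Finset.subset_univ _⟩
    have : p = ∑ v : p.1.support, p.1.coeff v.1 • x ⟨v.1, hp v.1 v.2⟩ := by
      ext1
      simp only [AddSubmonoidClass.coe_finsetSum, SetLike.val_smul, x, smul_monomial, smul_eq_mul,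
        mul_one]
      conv_lhs => rw [p.1.as_sum]
      exact (Finset.sum_coe_sort p.1.support fun v => monomial v (p.1.coeff v)).symm
    rw [this]
    exact sum_mem fun v _ => Submodule.smul_mem _ _ (Submodule.subset_span ⟨_, rfl⟩)
  rw [Module.finrank_eq_card_basis (Module.Basis.mk hx hspan), Fintype.card_coe,
    Finset.card_finsuppAntidiag_nat_eq_choose, Finset.card_univ, Fintype.card_fin,
    show n + 1 + k - 1 = n + k by omega, add_comm k n, Nat.choose_symm_add]

/-- The homomorphism that multiplies the part of degree `m` of a polynomial by `T ^ m`. -/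
noncomputable def homogenizer (σ R : Type*) [CommRing R] :
    MvPolynomial σ R →ₐ[R] Polynomial (MvPolynomial σ R) :=
  aeval fun i => Polynomial.C (X i) * Polynomial.X

lemma homogenizer_monomial {σ R : Type*} [CommRing R] (v : σ →₀ ℕ) (r : R) :
    homogenizer σ R (monomial v r) = Polynomial.monomial v.degree (monomial v r) := by
  rw [homogenizer, aeval_monomial, monomial_eq, ← Polynomial.C_mul_X_pow_eq_monomial, map_mul,
    Finsupp.degree_apply, Finsupp.prod, Finsupp.prod, map_prod, ← Finset.prod_pow_eq_pow_sum]
  simp only [mul_pow, Finset.prod_mul_distrib, map_pow]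
  rw [mul_assoc]
  rfl

lemma coeff_homogenizer {σ R : Type*} [CommRing R] (p : MvPolynomial σ R) (m : ℕ) :
    (homogenizer σ R p).coeff m = homogeneousComponent m p := by
  classical
  induction p using MvPolynomial.induction_on' with
  | monomial v r =>
    rw [homogenizer_monomial, Polynomial.coeff_monomial]
    split_ifs with h
    · rw [homogeneousComponent_eq_self (isHomogeneous_monomial _ h)]
    · exact (homogeneousComponent_of_mem (isHomogeneous_monomial r rfl) |>.trans
        (if_neg (Ne.symm h))).symm
  | add p q hp hq => rw [map_add, map_add, Polynomial.coeff_add, hp, hq]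

/-- Under `homogenizer` a nonzero form becomes a monomial in `T`. Top and bottom `T`-degrees are
both additive on products, so if they coincide for `p q` they coincide for each factor. -/
lemma isHomogeneous_totalDegree_of_mul {σ R : Type*} [CommRing R] [IsDomain R] {D : ℕ}
    {p q : MvPolynomial σ R} (h : (p * q).IsHomogeneous D) (h0 : p * q ≠ 0) :
    q.IsHomogeneous q.totalDegree := by
  have hinj : Function.Injective (homogenizer σ R) := by
    rw [injective_iff_map_eq_zero]
    intro f hf
    rw [← sum_homogeneousComponent f]
    refine Finset.sum_eq_zero fun m _ => ?_
    rw [← coeff_homogenizer, hf, Polynomial.coeff_zero]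
  have hpq : homogenizer σ R (p * q) = Polynomial.monomial D (p * q) := by
    ext1 m
    rw [coeff_homogenizer, Polynomial.coeff_monomial, homogeneousComponent_of_mem h]
    simp only [eq_comm]
  have hp0 : homogenizer σ R p ≠ 0 := (map_ne_zero_iff _ hinj).2 (left_ne_zero_of_mul h0)
  have hq0 : homogenizer σ R q ≠ 0 := (map_ne_zero_iff _ hinj).2 (right_ne_zero_of_mul h0)
  have h1 := Polynomial.natDegree_mul hp0 hq0
  have h2 := Polynomial.natTrailingDegree_mul hp0 hq0
  rw [← map_mul, hpq, Polynomial.natDegree_monomial_eq _ h0] at h1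
  rw [← map_mul, hpq, Polynomial.natTrailingDegree_monomial h0] at h2
  have h3 := Polynomial.natTrailingDegree_le_natDegree (homogenizer σ R p)
  have h4 := Polynomial.natTrailingDegree_le_natDegree (homogenizer σ R q)
  have hq : ∀ N, (homogenizer σ R q).natDegree = N → q.IsHomogeneous N := by
    intro N hN
    rw [← sum_homogeneousComponent q]
    refine IsHomogeneous.sum (Finset.range (q.totalDegree + 1))
      (fun m => homogeneousComponent m q) _ fun m _ => ?_
    rcases eq_or_ne m N with rfl | hm
    · exact homogeneousComponent_isHomogeneous _ q
    · rw [← coeff_homogenizer]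
      have : (homogenizer σ R q).coeff m = 0 := by
        rcases lt_or_gt_of_ne hm with hm | hm
        · exact Polynomial.coeff_eq_zero_of_lt_natTrailingDegree (by omega)
        · exact Polynomial.coeff_eq_zero_of_natDegree_lt (hN ▸ hm)
      rw [this]
      exact isHomogeneous_zero _ _ _
  have hq := hq _ rfl
  rwa [hq.totalDegree (right_ne_zero_of_mul h0)]

lemma exists_eq_polyGcd_mul {n : ℕ} (f₁ f₂ : MvPolynomial (Fin (n + 1)) ℂ) :
    ∃ a b, f₁ = polyGcd f₁ f₂ * a ∧ f₂ = polyGcd f₁ f₂ * b ∧ IsRelPrime a b := by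
  let := UniqueFactorizationMonoid.toGCDMonoid (MvPolynomial (Fin (n + 1)) ℂ)
  obtain ⟨a, b, ha, hb, hab⟩ := extract_gcd f₁ f₂
  exact ⟨a, b, ha, hb, gcd_isUnit_iff_isRelPrime.1 hab⟩

/-- Syzygies of two coprime polynomials. -/
lemma exists_syzygy {R : Type*} [CommRing R] [IsDomain R] [DecompositionMonoid R] {a b l m : R}
    (hab : IsRelPrime a b) (ha : a ≠ 0) (h : a * l + b * m = 0) :
    ∃ e, m = a * e ∧ l = - (b * e) := by
  obtain ⟨e, rfl⟩ : a ∣ m := hab.dvd_of_dvd_mul_left ⟨-l, by linear_combination h⟩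
  exact ⟨e, rfl, mul_left_cancel₀ ha (by linear_combination h)⟩

end Forms

/-! ### Syzygies over `ℂ[s, t]` -/

section LineRing

lemma exists_of_X_one_mul_eq {p q : LineRing} (h : (X 1 : LineRing) * p = X 0 * q) :
    ∃ l, p = l * X 0 ∧ q = l * X 1 := by
  obtain ⟨l, rfl⟩ : (X 0 : LineRing) ∣ p := by
    simpa using X_pow_dvd_of_mul_eq (a := 1) (b := 1) (p := p) (q := q) (by simpa using h)
  exact ⟨l, mul_comm _ _, mul_left_cancel₀ (X_ne_zero (R := ℂ) (0 : Fin 2))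
    (by linear_combination -h)⟩

/-- The syzygies of `t², -st, s²` are generated by two linear ones: `s` divides `x`, and after
cancelling `s` the rest is a relation between `t` and `s`. This identifies the kernel of `𝒪³ → 𝒪(2)`
with `𝒪(-1)²`. -/
lemma exists_of_quadratic_relation {x y z : LineRing}
    (h : (X 1 : LineRing) ^ 2 * x - X 0 * X 1 * y + X 0 ^ 2 * z = 0) :
    ∃ l m, x = l * X 0 ∧ y = l * X 1 + m * X 0 ∧ z = m * X 1 := by
  obtain ⟨l, rfl⟩ : (X 0 : LineRing) ∣ x := by
    simpa using X_pow_dvd_of_mul_eq (a := 1) (b := 2) (p := x) (q := X 1 * y - X 0 * z)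
      (by linear_combination h)
  obtain ⟨m, h1, h2⟩ := exists_of_X_one_mul_eq (p := y - l * X 1) (q := z)
    (mul_left_cancel₀ (X_ne_zero (R := ℂ) (0 : Fin 2)) (by linear_combination -h))
  exact ⟨l, m, mul_comm _ _, by linear_combination h1, h2⟩

end LineRing

/-! ### The case of a gcd of degree less than `d - 1` -/

section Generic

variable {n d : ℕ} {f₁ f₂ : MvPolynomial (Fin (n + 1)) ℂ}

/-- The product of two forms. -/
noncomputable def mulForm {σ R : Type*} [CommRing R] {a b m : ℕ} {f : MvPolynomial σ R}
    (hf : f.IsHomogeneous a) (hm : m = a + b) (l : homogeneousSubmodule σ R b) : homogeneousSubmodule σ R m :=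
  ⟨f * l.1, hm ▸ hf.mul l.2⟩

/-- The coordinates of the products of a linear form with `s f₁ + t f₂` when the products of
`f₁` and `f₂` with the elements of a basis of the linear forms are part of a basis. -/
lemma lineForm_mul_eq_formOfCoords_of_generic {k : ℕ} {κ μ : Type*} [Fintype κ] [Fintype μ]
    (w : κ → homogeneousSubmodule (Fin (n + 1)) ℂ 1)
    (u : (κ ⊕ κ) ⊕ μ → homogeneousSubmodule (Fin (n + 1)) ℂ k)
    (h₁ : ∀ i, (u (.inl (.inl i))).1 = f₁ * (w i).1)
    (h₂ : ∀ i, (u (.inl (.inr i))).1 = f₂ * (w i).1) (l : κ → LineRing) :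
    lineForm f₁ f₂ * formOfCoords w l =
      formOfCoords u (Sum.elim (Sum.elim (fun i => l i * X 0) fun i => l i * X 1) 0) := by
  rw [lineForm_mul_formOfCoords, formOfCoords_apply, Fintype.sum_sum_type, Fintype.sum_sum_type]
  simp [h₁, h₂, Finset.sum_add_distrib]

/-- The map to `𝒪(1)^(n+1) ⊕ 𝒪^μ`. -/
noncomputable def genericMap (κ μ : Type*) :
    ((κ ⊕ κ) ⊕ μ → LineRing) →ₗ[LineRing] (κ ⊕ μ → LineRing) :=
  LinearMap.pi (Sum.elim
    (fun i => (X 1 : LineRing) • LinearMap.proj (.inl (.inl i)) -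
      (X 0 : LineRing) • LinearMap.proj (.inl (.inr i)))
    fun x => LinearMap.proj (.inr x))

lemma genericMap_inl {κ μ : Type*} (c : (κ ⊕ κ) ⊕ μ → LineRing) (i : κ) :
    genericMap κ μ c (.inl i) = X 1 * c (.inl (.inl i)) - X 0 * c (.inl (.inr i)) := rfl

lemma genericMap_inr {κ μ : Type*} (c : (κ ⊕ κ) ⊕ μ → LineRing) (x : μ) :
    genericMap κ μ c (.inr x) = c (.inr x) := rfl

lemma genericMap_eq_zero_iff {κ μ : Type*} (c : (κ ⊕ κ) ⊕ μ → LineRing) :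
    genericMap κ μ c = 0 ↔ ∃ l : κ → LineRing,
      c = Sum.elim (Sum.elim (fun i => l i * X 0) fun i => l i * X 1) 0 := by
  constructor
  · intro h
    have h1 : ∀ i, ∃ l, c (.inl (.inl i)) = l * X 0 ∧ c (.inl (.inr i)) = l * X 1 := fun i =>
      exists_of_X_one_mul_eq (sub_eq_zero.1 ((genericMap_inl c i).symm.trans (congrFun h _)))
    choose l hl hl' using h1
    refine ⟨l, funext fun x => ?_⟩
    rcases x with (i | i) | x
    · exact hl i
    · exact hl' i
    · exact congrFun h (.inr x)
  · rintro ⟨l, rfl⟩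
    funext x
    rcases x with i | x
    · rw [genericMap_inl]
      simp only [Sum.elim_inl, Sum.elim_inr, Pi.zero_apply]
      ring
    · rfl

/-- With `f₁ = g a` and `f₂ = g b`, a relation `f₁ l + f₂ m = 0` forces `a ∣ m`. Here `a` has degree
at least `2` and `m` is linear, so `m` and then `l` vanish. -/
lemma linearIndependent_generic (hf₁ : f₁.IsHomogeneous d) (hf₂ : f₂.IsHomogeneous d)
    (h1 : f₁ ≠ 0) {κ : Type*} [Fintype κ] {w : κ → homogeneousSubmodule (Fin (n + 1)) ℂ 1}
    (hw : LinearIndependent ℂ w) (hdeg : (polyGcd f₁ f₂).totalDegree + 1 < d) :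
    LinearIndependent ℂ (Sum.elim (fun i => mulForm hf₁ rfl (w i))
      fun i => mulForm hf₂ rfl (w i) : κ ⊕ κ → homogeneousSubmodule (Fin (n + 1)) ℂ (d + 1)) := by
  obtain ⟨a, b, ha, hb, hab⟩ := exists_eq_polyGcd_mul f₁ f₂
  set g := polyGcd f₁ f₂
  have hg0 : g ≠ 0 := by rintro h; rw [h, zero_mul] at ha; exact h1 ha
  have ha0 : a ≠ 0 := by rintro rfl; rw [mul_zero] at ha; exact h1 ha
  have hdega : g.totalDegree + a.totalDegree = d := by
    rw [← totalDegree_mul_of_isDomain hg0 ha0, ← ha, hf₁.totalDegree h1]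
  rw [Fintype.linearIndependent_iff]
  intro c hc
  have key : ∀ l m : homogeneousSubmodule (Fin (n + 1)) ℂ 1, f₁ * l.1 + f₂ * m.1 = 0 →
      l = 0 ∧ m = 0 := by
    intro l m h
    obtain ⟨e, he, he'⟩ := exists_syzygy hab ha0 (l := l.1) (m := m.1)
      (mul_left_cancel₀ hg0 (by
        rw [mul_zero, mul_add, ← mul_assoc, ← mul_assoc, ← ha, ← hb, h]))
    have he0 : e = 0 := by
      by_contra hne
      have hm : m.1.totalDegree ≤ 1 := IsHomogeneous.totalDegree_le m.2
      rw [he, totalDegree_mul_of_isDomain ha0 hne] at hm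
      omega
    rw [he0, mul_zero] at he he'
    exact ⟨Subtype.ext (he'.trans neg_zero), Subtype.ext he⟩
  have := key (∑ i, c (.inl i) • w i) (∑ i, c (.inr i) • w i) (by
    have := congrArg Subtype.val hc
    rw [Fintype.sum_sum_type] at this
    simpa [mulForm, AddSubmonoidClass.coe_finsetSum, Finset.mul_sum] using this)
  rintro (i | i)
  · exact Fintype.linearIndependent_iff.1 hw _ this.1 i
  · exact Fintype.linearIndependent_iff.1 hw _ this.2 i

theorem not_hasSplittingType_of_totalDegree_lt (hn : 2 ≤ n) (hf₁ : f₁.IsHomogeneous d)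
    (hf₂ : f₂.IsHomogeneous d) (h1 : f₁ ≠ 0) (hdeg : (polyGcd f₁ f₂).totalDegree + 1 < d) :
    ¬ HasSplittingType d (d + 1) f₁ f₂ (jumpingType n (verlindeRank n d (d + 1))) := by
  let w := Module.finBasis ℂ (homogeneousSubmodule (Fin (n + 1)) ℂ 1)
  have hv := linearIndependent_generic hf₁ hf₂ h1 w.linearIndependent hdeg
  obtain ⟨μ, _, u, hu⟩ := exists_basis_extending hv
  have hcard := Module.finrank_eq_card_basis u
  rw [finrank_homogeneousSubmodule, Fintype.card_sum, Fintype.card_sum, Fintype.card_fin,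
    finrank_homogeneousSubmodule] at hcard
  -- The rank is `2 (n + 1) + |μ| - (n + 1)`; positivity ensures that the entry `2` of the tuple
  -- occurs.
  have hr : 0 < verlindeRank n d (d + 1) := by
    rw [verlindeRank, show d + 1 + n - d = 1 + n by omega, hcard]
    have : 0 < (1 + n).choose n := Nat.choose_pos (by omega)
    omega
  obtain ⟨ψ, hψ, hψφ⟩ := exists_injective_of_ker_eq hn rfl hf₁ hf₂ u w (genericMap _ μ) fun c => by
    rw [genericMap_eq_zero_iff]
    refine exists_congr fun l => ?_
    rw [lineForm_mul_eq_formOfCoords_of_generic w u (fun i => by rw [hu]; rfl)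
      (fun i => by rw [hu]; rfl), (formOfCoords_injective u.linearIndependent).eq_iff]
  rintro ⟨-, h⟩
  refine not_sheafIso_twistDegree ψ hψ (fun m x hx j => ?_) (j₀ := ⟨0, hr⟩)
    (by simp [jumpingType]) h
  obtain ⟨c, hc, rfl⟩ := (mem_lineDegree_iff_exists_coords hn u).1 hx
  rw [hψφ]
  rcases j with i | x
  · rw [genericMap_inl]
    refine IsHomogeneous.totalDegree_le ?_
    rw [add_comm m 1]
    exact ((isHomogeneous_X _ _).mul (hc _)).sub ((isHomogeneous_X _ _).mul (hc _))
  · rw [genericMap_inr]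
    exact (hc _).totalDegree_le.trans (by omega)

end Generic

/-! ### The case of a gcd of degree at least `d - 1` -/

section Special

variable {n d : ℕ} {f₁ f₂ : MvPolynomial (Fin (n + 1)) ℂ}

/-- The coordinates of the product of `s f₁ + t f₂` with the linear form with coordinates `l`, when
`f₁ = g a` and `f₂ = g b` for linear forms `a`, `b`. -/
noncomputable def specialCoords {μ : Type*} (ν : Type*) (l : Fin 2 ⊕ μ → LineRing) :
    (Fin 3 ⊕ (μ ⊕ μ)) ⊕ ν → LineRing :=
  Sum.elim (Sum.elim
    ![l (.inl 0) * X 0, l (.inl 0) * X 1 + l (.inl 1) * X 0, l (.inl 1) * X 1]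
    (Sum.elim (fun i => l (.inr i) * X 0) fun i => l (.inr i) * X 1)) 0

/-- The single basis vector `.inl (.inl 1)` represents both `f₁ b` and `f₂ a`; this coincidence
produces the mixed middle coordinate of `specialCoords`. -/
lemma lineForm_mul_eq_formOfCoords_of_special {k : ℕ} {μ ν : Type*} [Fintype μ] [Fintype ν]
    (w : Fin 2 ⊕ μ → homogeneousSubmodule (Fin (n + 1)) ℂ 1)
    (u : (Fin 3 ⊕ (μ ⊕ μ)) ⊕ ν → homogeneousSubmodule (Fin (n + 1)) ℂ k)
    (h₀ : (u (.inl (.inl 0))).1 = f₁ * (w (.inl 0)).1)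
    (h₁ : (u (.inl (.inl 1))).1 = f₁ * (w (.inl 1)).1)
    (h₁' : (u (.inl (.inl 1))).1 = f₂ * (w (.inl 0)).1)
    (h₂ : (u (.inl (.inl 2))).1 = f₂ * (w (.inl 1)).1)
    (hμ₁ : ∀ i, (u (.inl (.inr (.inl i)))).1 = f₁ * (w (.inr i)).1)
    (hμ₂ : ∀ i, (u (.inl (.inr (.inr i)))).1 = f₂ * (w (.inr i)).1) (l : Fin 2 ⊕ μ → LineRing) :
    lineForm f₁ f₂ * formOfCoords w l = formOfCoords u (specialCoords ν l) := by
  rw [lineForm_mul_formOfCoords, formOfCoords_apply, Fintype.sum_sum_type, Fintype.sum_sum_type,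
    Fintype.sum_sum_type, Fintype.sum_sum_type, Fin.sum_univ_two, Fin.sum_univ_three,
    ← h₀, ← h₁, ← h₁', ← h₂]
  simp only [← hμ₁, ← hμ₂, specialCoords, Sum.elim_inl, Sum.elim_inr, Pi.zero_apply, zero_smul,
    Finset.sum_const_zero, add_zero, Finset.sum_add_distrib, Matrix.cons_val_zero,
    Matrix.cons_val_one, Matrix.cons_val, add_smul]
  abel

/-- The map to `𝒪(2) ⊕ 𝒪(1)^μ ⊕ 𝒪^ν`. -/
noncomputable def specialMap (μ ν : Type*) :
    ((Fin 3 ⊕ (μ ⊕ μ)) ⊕ ν → LineRing) →ₗ[LineRing] (Fin 1 ⊕ μ ⊕ ν → LineRing) :=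
  LinearMap.pi (Sum.elim
    (fun _ => (X 1 ^ 2 : LineRing) • LinearMap.proj (.inl (.inl 0)) -
      (X 0 * X 1 : LineRing) • LinearMap.proj (.inl (.inl 1)) +
      (X 0 ^ 2 : LineRing) • LinearMap.proj (.inl (.inl 2)))
    (Sum.elim
      (fun i => (X 1 : LineRing) • LinearMap.proj (.inl (.inr (.inl i))) -
        (X 0 : LineRing) • LinearMap.proj (.inl (.inr (.inr i))))
      fun x => LinearMap.proj (.inr x)))

variable {μ ν : Type*}

lemma specialMap_inl (c : (Fin 3 ⊕ (μ ⊕ μ)) ⊕ ν → LineRing) (x : Fin 1) :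
    specialMap μ ν c (.inl x) = X 1 ^ 2 * c (.inl (.inl 0)) - X 0 * X 1 * c (.inl (.inl 1)) +
      X 0 ^ 2 * c (.inl (.inl 2)) := rfl

lemma specialMap_inr_inl (c : (Fin 3 ⊕ (μ ⊕ μ)) ⊕ ν → LineRing) (i : μ) :
    specialMap μ ν c (.inr (.inl i)) =
      X 1 * c (.inl (.inr (.inl i))) - X 0 * c (.inl (.inr (.inr i))) := rfl

lemma specialMap_inr_inr (c : (Fin 3 ⊕ (μ ⊕ μ)) ⊕ ν → LineRing) (x : ν) :
    specialMap μ ν c (.inr (.inr x)) = c (.inr x) := rfl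

lemma specialMap_eq_zero_iff (c : (Fin 3 ⊕ (μ ⊕ μ)) ⊕ ν → LineRing) :
    specialMap μ ν c = 0 ↔ ∃ l : Fin 2 ⊕ μ → LineRing, c = specialCoords ν l := by
  constructor
  · intro h
    have h1 : ∀ i, ∃ l, c (.inl (.inr (.inl i))) = l * X 0 ∧ c (.inl (.inr (.inr i))) = l * X 1 :=
      fun i => exists_of_X_one_mul_eq
        (sub_eq_zero.1 ((specialMap_inr_inl c i).symm.trans (congrFun h _)))
    choose l hl hl' using h1
    obtain ⟨p, q, h0, h1, h2⟩ := exists_of_quadratic_relation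
      ((specialMap_inl c 0).symm.trans (congrFun h _))
    refine ⟨Sum.elim ![p, q] l, funext fun x => ?_⟩
    rcases x with (i | i | i) | x
    · fin_cases i
      · exact h0
      · exact h1
      · exact h2
    · exact hl i
    · exact hl' i
    · exact congrFun h (.inr (.inr x))
  · rintro ⟨l, rfl⟩
    funext x
    rcases x with x | i | x
    · rw [specialMap_inl]
      simp only [specialCoords, Sum.elim_inl, Matrix.cons_val_zero,
        Matrix.cons_val_one, Matrix.cons_val, Pi.zero_apply]
      ring
    · rw [specialMap_inr_inl]
      simp only [specialCoords, Sum.elim_inl, Sum.elim_inr, Pi.zero_apply]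
      ring
    · rfl

/-- A preimage of `z ^ 2 • y` under `specialMap`, where `z` is a coordinate of `ℙ¹`. -/
noncomputable def specialLift (i : Fin 2) (y : Fin 1 ⊕ μ ⊕ ν → LineRing) :
    (Fin 3 ⊕ (μ ⊕ μ)) ⊕ ν → LineRing :=
  Sum.elim (Sum.elim
    (if i = 0 then ![0, 0, y (.inl 0)] else ![y (.inl 0), 0, 0])
    (Sum.elim (fun j => if i = 0 then 0 else X 1 * y (.inr (.inl j)))
      fun j => if i = 0 then -(X 0 * y (.inr (.inl j))) else 0))
    fun x => X i ^ 2 * y (.inr (.inr x))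

lemma specialMap_specialLift (i : Fin 2) (y : Fin 1 ⊕ μ ⊕ ν → LineRing) :
    specialMap μ ν (specialLift i y) = (X i : LineRing) ^ 2 • y := by
  funext x
  rcases x with x | j | x
  · obtain rfl := Subsingleton.elim x 0
    rw [specialMap_inl]
    fin_cases i <;> simp [specialLift]
  · rw [specialMap_inr_inl]
    fin_cases i <;> simp [specialLift] <;> ring
  · rfl

/-- The twists in `𝒪(2) ⊕ 𝒪(1)^μ ⊕ 𝒪^ν`. -/
def specialTwist (μ ν : Type*) : Fin 1 ⊕ μ ⊕ ν → ℕ :=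
  Sum.elim (fun _ => 2) (Sum.elim (fun _ => 1) fun _ => 0)

lemma specialMap_isHomogeneous {m : ℕ} {c : (Fin 3 ⊕ (μ ⊕ μ)) ⊕ ν → LineRing}
    (hc : ∀ j, (c j).IsHomogeneous m) (x : Fin 1 ⊕ μ ⊕ ν) :
    (specialMap μ ν c x).IsHomogeneous (specialTwist μ ν x + m) := by
  rcases x with x | i | x
  · rw [specialMap_inl]
    exact (((isHomogeneous_X_pow _ 2).mul (hc _)).sub
      (((isHomogeneous_X _ _).mul (isHomogeneous_X _ _)).mul (hc _))).add
      ((isHomogeneous_X_pow _ 2).mul (hc _))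
  · rw [specialMap_inr_inl]
    exact ((isHomogeneous_X _ _).mul (hc _)).sub ((isHomogeneous_X _ _).mul (hc _))
  · rw [specialMap_inr_inr]
    exact (zero_add m).symm ▸ hc _

lemma specialLift_isHomogeneous {m : ℕ} {y : Fin 1 ⊕ μ ⊕ ν → LineRing}
    (hy : ∀ x, (y x).IsHomogeneous (specialTwist μ ν x + m)) (i : Fin 2)
    (j : (Fin 3 ⊕ (μ ⊕ μ)) ⊕ ν) : (specialLift i y j).IsHomogeneous (2 + m) := by
  have h0 := hy (.inl 0)
  have h1 : ∀ (p : Fin 2) (j : μ), ((X p : LineRing) * y (.inr (.inl j))).IsHomogeneous (2 + m) :=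
    fun p j => by
      have := (isHomogeneous_X ℂ p).mul (hy (.inr (.inl j)))
      rwa [← add_assoc] at this
  have h2 : ∀ (p : Fin 2) (x : ν),
      ((X p : LineRing) ^ 2 * y (.inr (.inr x))).IsHomogeneous (2 + m) := fun p x => by
    have := (isHomogeneous_X_pow (R := ℂ) p 2).mul (hy (.inr (.inr x)))
    rwa [← add_assoc] at this
  have hz : (0 : LineRing).IsHomogeneous (2 + m) := isHomogeneous_zero _ _ _
  rcases j with (j | j | j) | j
  · fin_cases i <;> fin_cases j <;> first | exact h0 | exact hz
  · fin_cases i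
    · exact hz
    · exact h1 1 j
  · fin_cases i
    · exact (h1 0 j).neg
    · exact hz
  · exact h2 i j

lemma exists_equiv_jumpingType [Fintype μ] [Fintype ν] {r : ℕ} (hn : 1 ≤ n)
    (hμ : Fintype.card μ = n - 1) (hr : r = n + Fintype.card ν) :
    ∃ e : Fin r ≃ Fin 1 ⊕ μ ⊕ ν, ∀ j, jumpingType n r j = specialTwist μ ν (e j) := by
  let e' : Fin 1 ⊕ μ ⊕ ν ≃ Fin r :=
    ((Equiv.sumCongr (Equiv.refl _) ((Equiv.sumCongr (Fintype.equivFinOfCardEq hμ)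
      (Fintype.equivFin ν)).trans finSumFinEquiv)).trans finSumFinEquiv).trans
      (finCongr (by omega))
  refine ⟨e'.symm, fun j => ?_⟩
  obtain ⟨x, rfl⟩ := e'.surjective j
  rw [Equiv.symm_apply_apply]
  rcases x with x | i | x
  · obtain rfl := Subsingleton.elim x 0
    simp [e', jumpingType, specialTwist]
  · have := (Fintype.equivFinOfCardEq hμ i).2
    simp only [jumpingType, e', specialTwist, Equiv.trans_apply, Equiv.sumCongr_apply, Sum.map_inl,
      Sum.map_inr, finSumFinEquiv_apply_left, finSumFinEquiv_apply_right, finCongr_apply,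
      Fin.val_cast, Fin.val_natAdd, Fin.val_castAdd, Sum.elim_inl, Sum.elim_inr]
    rw [if_neg (by omega), if_pos (by omega)]
    rfl
  · simp only [jumpingType, e', specialTwist, Equiv.trans_apply, Equiv.sumCongr_apply,
      Sum.map_inr, finSumFinEquiv_apply_right, finCongr_apply,
      Fin.val_cast, Fin.val_natAdd, Sum.elim_inr]
    rw [if_neg (by omega), if_neg (by omega)]
    rfl

lemma mem_twistDegree_iff {r : ℕ} {b : Fin r → ℤ} {c : Fin r → ℕ} (hb : ∀ j, b j = c j) {m : ℕ}
    {q : Fin r → LineRing} : q ∈ twistDegree b m ↔ ∀ j, (q j).IsHomogeneous (c j + m) := by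
  refine forall_congr' fun j => ⟨fun h v hv => ?_, fun h v hv => ?_⟩
  · have := h v (mem_support_iff.2 hv)
    rw [hb] at this
    rw [Pi.one_def, ← Finsupp.degree_eq_weight_one]
    omega
  · have := h.degree_eq_sum_deg_support hv
    rw [← Finsupp.degree_apply] at this
    rw [hb, ← this]
    push_cast
    ring

lemma antitone_jumpingType (n r : ℕ) : Antitone (jumpingType n r) := by
  intro i j hij
  have : (i : ℕ) ≤ j := hij
  unfold jumpingType
  split_ifs <;> omega

/-- The product `f₂ a` is left out of the family, being the same as `f₁ b`. In a relation `f₁ l + f₂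
m = 0` the linear form `m` is `a` times a constant, but `m` has no `a`-component, so the constant is
zero. -/
lemma linearIndependent_special {a b g : MvPolynomial (Fin (n + 1)) ℂ} (hab : IsRelPrime a b)
    (hg : g ≠ 0) (hf₁ : f₁.IsHomogeneous d)
    (hf₂ : f₂.IsHomogeneous d) (h₁ : f₁ = g * a) (h₂ : f₂ = g * b) [Fintype μ]
    {w : Fin 2 ⊕ μ → homogeneousSubmodule (Fin (n + 1)) ℂ 1} (hw : LinearIndependent ℂ w)
    (ha : (w (.inl 0)).1 = a) :
    LinearIndependent ℂ (Sum.elim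
      ![mulForm hf₁ rfl (w (.inl 0)), mulForm hf₁ rfl (w (.inl 1)), mulForm hf₂ rfl (w (.inl 1))]
      (Sum.elim (fun i => mulForm hf₁ rfl (w (.inr i))) fun i => mulForm hf₂ rfl (w (.inr i))) :
        Fin 3 ⊕ (μ ⊕ μ) → homogeneousSubmodule (Fin (n + 1)) ℂ (d + 1)) := by
  classical
  have ha0 : a ≠ 0 := fun h => hw.ne_zero (.inl 0) (Subtype.ext (ha.trans h))
  rw [Fintype.linearIndependent_iff] at hw ⊢
  intro c hc
  let c₁ : Fin 2 ⊕ μ → ℂ := Sum.elim ![c (.inl 0), c (.inl 1)] fun i => c (.inr (.inl i))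
  -- The entry `0` records the omitted product `f₂ a`.
  let c₂ : Fin 2 ⊕ μ → ℂ := Sum.elim ![0, c (.inl 2)] fun i => c (.inr (.inr i))
  have h : f₁ * (∑ i, c₁ i • w i).1 + f₂ * (∑ i, c₂ i • w i).1 = 0 := by
    have := congrArg Subtype.val hc
    rw [Fintype.sum_sum_type, Fintype.sum_sum_type, Fin.sum_univ_three] at this
    rw [Fintype.sum_sum_type, Fintype.sum_sum_type, Fin.sum_univ_two, Fin.sum_univ_two]
    simp only [mulForm, Sum.elim_inl, Sum.elim_inr, Matrix.cons_val_zero, Matrix.cons_val_one,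
      Matrix.cons_val, Submodule.coe_add, SetLike.val_smul, AddSubmonoidClass.coe_finsetSum,
      Submodule.coe_zero, c₁, c₂, zero_smul, zero_add, mul_add, Finset.mul_sum,
      mul_smul_comm] at this ⊢
    rw [← this]
    abel
  obtain ⟨e, he, he'⟩ := exists_syzygy hab ha0 (l := (∑ i, c₁ i • w i).1)
    (m := (∑ i, c₂ i • w i).1) (mul_left_cancel₀ hg (by
      rw [mul_zero, mul_add, ← mul_assoc, ← mul_assoc, ← h₁, ← h₂, h]))
  obtain ⟨z, rfl⟩ : ∃ z, e = C z := by
    rcases eq_or_ne e 0 with rfl | hne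
    · exact ⟨0, (map_zero C).symm⟩
    · have h1 : (∑ i, c₂ i • w i).1.totalDegree ≤ 1 :=
        IsHomogeneous.totalDegree_le (∑ i, c₂ i • w i).2
      have h2 : a.totalDegree = 1 := by
        rw [← ha] at ha0 ⊢
        exact IsHomogeneous.totalDegree (w (.inl 0)).2 ha0
      rw [he, totalDegree_mul_of_isDomain ha0 hne, h2] at h1
      exact ⟨_, totalDegree_eq_zero_iff_eq_C.1 (by omega)⟩
  have hz₂ := hw (c₂ - Pi.single (.inl 0) z) (by
    simp only [Pi.sub_apply, sub_smul, Finset.sum_sub_distrib]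
    rw [sub_eq_zero]
    ext1
    rw [he, ← ha, mul_comm, ← smul_eq_C_mul]
    simp [Pi.single_apply, ite_smul])
  have hz : z = 0 := by simpa [c₂] using hz₂ (.inl 0)
  subst hz
  have hz₁ := hw c₁ (by
    ext1
    rw [he', map_zero, mul_zero, neg_zero]
    rfl)
  rintro (i | i | i)
  · fin_cases i
    · exact hz₁ (.inl 0)
    · exact hz₁ (.inl 1)
    · simpa [c₂] using hz₂ (.inl 1)
  · exact hz₁ (.inr i)
  · simpa [c₂] using hz₂ (.inr i)

/-- The cofactors of the gcd have equal degree, at most `1`. Degree `0` would make both constant and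
`f₁`, `f₂` proportional. -/
lemma exists_linear_factors (hf₁ : f₁.IsHomogeneous d) (hf₂ : f₂.IsHomogeneous d)
    (hf : LinearIndependent ℂ ![f₁, f₂]) (hdeg : d ≤ (polyGcd f₁ f₂).totalDegree + 1) :
    ∃ g a b : MvPolynomial (Fin (n + 1)) ℂ, g ≠ 0 ∧ a.IsHomogeneous 1 ∧ b.IsHomogeneous 1 ∧
      f₁ = g * a ∧ f₂ = g * b ∧ IsRelPrime a b ∧ LinearIndependent ℂ ![a, b] := by
  obtain ⟨a, b, ha, hb, hab⟩ := exists_eq_polyGcd_mul f₁ f₂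
  set g := polyGcd f₁ f₂
  have h1 : f₁ ≠ 0 := hf.ne_zero 0
  have h2 : f₂ ≠ 0 := hf.ne_zero 1
  have hg0 : g ≠ 0 := by rintro h; rw [h, zero_mul] at ha; exact h1 ha
  have ha0 : a ≠ 0 := by rintro rfl; rw [mul_zero] at ha; exact h1 ha
  have hb0 : b ≠ 0 := by rintro rfl; rw [mul_zero] at hb; exact h2 hb
  have hdega : g.totalDegree + a.totalDegree = d := by
    rw [← totalDegree_mul_of_isDomain hg0 ha0, ← ha, hf₁.totalDegree h1]
  have hdegb : g.totalDegree + b.totalDegree = d := by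
    rw [← totalDegree_mul_of_isDomain hg0 hb0, ← hb, hf₂.totalDegree h2]
  have hind : LinearIndependent ℂ ![a, b] := by
    rw [LinearIndependent.pair_iff] at hf ⊢
    intro s t h
    refine hf s t ?_
    rw [ha, hb, ← mul_smul_comm, ← mul_smul_comm, ← mul_add, h, mul_zero]
  have hne : a.totalDegree ≠ 0 := fun h => by
    obtain ⟨x, hx⟩ : ∃ x, a = C x := ⟨_, totalDegree_eq_zero_iff_eq_C.1 h⟩
    obtain ⟨y, hy⟩ : ∃ y, b = C y := ⟨_, totalDegree_eq_zero_iff_eq_C.1 (by omega)⟩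
    have := (LinearIndependent.pair_iff.1 hind y (-x) (by
      rw [hx, hy, smul_eq_C_mul, smul_eq_C_mul, map_neg]; ring)).1
    rw [this, map_zero] at hy
    exact hb0 hy
  have ha1 := isHomogeneous_totalDegree_of_mul (ha ▸ hf₁) (ha ▸ h1)
  have hb1 := isHomogeneous_totalDegree_of_mul (hb ▸ hf₂) (hb ▸ h2)
  rw [show a.totalDegree = 1 by omega] at ha1
  rw [show b.totalDegree = 1 by omega] at hb1
  exact ⟨g, a, b, hg0, ha1, hb1, ha, hb, hab, hind⟩

theorem hasSplittingType_of_le_totalDegree (hn : 2 ≤ n) (hf₁ : f₁.IsHomogeneous d)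
    (hf₂ : f₂.IsHomogeneous d) (hf : LinearIndependent ℂ ![f₁, f₂])
    (hdeg : d ≤ (polyGcd f₁ f₂).totalDegree + 1) :
    HasSplittingType d (d + 1) f₁ f₂ (jumpingType n (verlindeRank n d (d + 1))) := by
  obtain ⟨g, a, b, hg, ha, hb, hga, hgb, hab, hind⟩ := exists_linear_factors hf₁ hf₂ hf hdeg
  have hind' : LinearIndependent ℂ
      (![⟨a, ha⟩, ⟨b, hb⟩] : Fin 2 → homogeneousSubmodule (Fin (n + 1)) ℂ 1) := by
    rw [LinearIndependent.pair_iff] at hind ⊢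
    exact fun s t h => hind s t (congrArg Subtype.val h)
  obtain ⟨μ, _, w, hw⟩ := exists_basis_extending hind'
  have hw0 : (w (.inl 0)).1 = a := by rw [hw]; rfl
  have hw1 : (w (.inl 1)).1 = b := by rw [hw]; rfl
  have hv := linearIndependent_special hab hg hf₁ hf₂ hga hgb w.linearIndependent hw0
  obtain ⟨ν, _, u, hu⟩ := exists_basis_extending hv
  have hcardw := Module.finrank_eq_card_basis w
  have hcard := Module.finrank_eq_card_basis u
  simp only [finrank_homogeneousSubmodule, Fintype.card_sum, Fintype.card_fin] at hcard hcardw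
  have hchoose : (1 + n).choose n = n + 1 := by rw [add_comm, Nat.choose_succ_self_right]
  -- Counting linear forms gives `|μ| = n - 1`; counting forms of degree `d + 1` gives rank `3 + 2
  -- (n - 1) + |ν| - (n + 1) = n + |ν|`.
  obtain ⟨e, he⟩ := exists_equiv_jumpingType (n := n) (μ := μ) (ν := ν)
    (r := verlindeRank n d (d + 1)) (by omega) (by omega) (by
      rw [verlindeRank, show d + 1 + n - d = 1 + n by omega]
      omega)
  let E := LinearEquiv.funCongrLeft LineRing LineRing e
  obtain ⟨ψ, hψ, hψφ⟩ := exists_injective_of_ker_eq hn rfl hf₁ hf₂ u w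
    (E.toLinearMap.comp (specialMap μ ν)) fun c => by
      rw [LinearMap.comp_apply, LinearEquiv.coe_coe, E.map_eq_zero_iff, specialMap_eq_zero_iff]
      refine exists_congr fun l => ?_
      rw [lineForm_mul_eq_formOfCoords_of_special w u (by rw [hu]; rfl) (by rw [hu]; rfl)
        (by rw [hu, hw0]; change f₁ * (w (.inl 1)).1 = _; rw [hw1, hga, hgb]; ring)
        (by rw [hu]; rfl) (fun i => by rw [hu]; rfl) (fun i => by rw [hu]; rfl),
        (formOfCoords_injective u.linearIndependent).eq_iff]
  -- The square of either coordinate kills the cokernel, so the exponent `2` serves for both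
  -- surjectivity conditions.
  have hpre : ∀ (i : Fin 2) (y : Fin (verlindeRank n d (d + 1)) → LineRing),
      ψ (lineClass d (d + 1) f₁ f₂ (formOfCoords u (specialLift i (E.symm y)))) =
        (X i : LineRing) ^ 2 • y := fun i y => by
    rw [hψφ, LinearMap.comp_apply, specialMap_specialLift, LinearEquiv.coe_coe, map_smul,
      E.apply_symm_apply]
  refine ⟨antitone_jumpingType _ _, sheafIso_of_injective ψ hψ (fun m x hx => ?_)
    (fun i y => ⟨2, _, hpre i y⟩) fun i m y hy => ⟨2, _, ?_, hpre i y⟩⟩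
  · obtain ⟨c, hc, rfl⟩ := (mem_lineDegree_iff_exists_coords hn u).1 hx
    rw [hψφ, mem_twistDegree_iff he]
    exact fun j => specialMap_isHomogeneous hc (e j)
  · rw [mem_twistDegree_iff he] at hy
    refine (mem_lineDegree_iff_exists_coords hn u).2 ⟨_, fun j => ?_, rfl⟩
    rw [add_comm m 2]
    refine specialLift_isHomogeneous (fun x => ?_) i j
    obtain ⟨j, rfl⟩ := e.surjective x
    rw [show E.symm y (e j) = y j from congrFun (E.apply_symm_apply y) j]
    exact hy j

end Special

end Verlinde

theorem corollary2p6 (n d k : ℕ) (hn : 1 < n) (hd : 1 ≤ d) (hk : k = d + 1)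
    (f₁ f₂ : MvPolynomial (Fin (n + 1)) ℂ)
    (hf₁ : f₁.IsHomogeneous d) (hf₂ : f₂.IsHomogeneous d)
    (hf : LinearIndependent ℂ ![f₁, f₂]) :
    Verlinde.HasSplittingType d k f₁ f₂
        (Verlinde.jumpingType n (Verlinde.verlindeRank n d k)) ↔
      d - 1 ≤ (Verlinde.polyGcd f₁ f₂).totalDegree := by
  subst hk
  constructor
  · intro h
    by_contra hlt
    exact Verlinde.not_hasSplittingType_of_totalDegree_lt hn hf₁ hf₂ (hf.ne_zero 0) (by omega) h
  · intro h
    exact Verlinde.hasSplittingType_of_le_totalDegree hn hf₁ hf₂ hf (by omega)
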